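/- **Setting.** An $H$-horizon MDP with $A$ actions has a finite state space $\mathcal S=\bigcup_{h=0}^{H}\mathcal S_h$ (disjoint stages, $\mathcal S_H=\{\bot\}$), the action set $[A]=\{1,\dots,A\}$ and a probability kernel $Q(\cdot\mid s,a)$ for the reward-next-state pair, supported on $[0,1]\times(\{\bot\}\cup\mathcal S_{h+1})$ for $s\in\mathcal S_h$, $h<H$, and on $\{(0,\bot)\}$ for $s=\bot$. Initial states are the elements of $\mathcal S_0$. For a (randomized, history-dependent) policy $\pi$, $v^\pi(s)$ and $q^\pi(s,a)$ are the total expected rewards from $s$, respectively from $s$ with first action $a$, and $v^\star=\sup_\pi v^\pi$, $q^\star=\sup_\pi q^\pi$. A featurized MDP is an MDP together with one or two feature-maps. For $B>0$ consider three classes, in which all features are in $\mathbb R^d$ with Euclidean norm at most $1$, and for each member there is some $\theta^\star\in\mathbb R^d$ with $\|\theta^\star\|_2\le B$ such that - $\mathcal M^{v^\star}_{B,d,H,A}$: $v^\star(s)=\langle\phi(s),\theta^\star\rangle$ for all states $s$; - $\mathcal M^{q^\star}_{B,d,H,A}$: $q^\star(s,a)=\langle\phi(s,a),\theta^\star\rangle$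 for all states $s$ and actions $a$; - $\mathcal M^{v^\star/q^\star\,\mathrm{reach}}_{B,d,H,A}$: there are two feature-maps, and $v^\star(s)=\langle\phi_v(s),\theta^\star\rangle$ and $q^\star(s,a)=\langle\phi_q(s,a),\theta^\star\rangle$ for all actions $a$ and all states $s$ that are reachable with positive probability from the initial states. $\mathcal M^{\mathrm{Pdet}}$ is the class of featurized MDPs with deterministic transitions (rewards may be random). A planner with global access is given the state space (with its stages) and the feature-maps. In an episode started at $s_0\in\mathcal S_0$ it is called in steps $t=0,\dots,H-1$ at the current state $S_t$. In each call it adaptively and possibly at random chooses pairs $(s,a)\in\mathcal S\times[A]$ to query, each query being answered by a fresh draw from $Q(\cdot\mid s,a)$, until it returns an action $A_t$; then $(R_{t+1},S_{t+1})\sim Q(\cdot\mid S_t,A_t)$. All its decisions may depend on everything that happened before in the episode. The planner is $\delta$-sound for a class if, for each member of the class and each $s_0\in\mathcal S_0$, its expected total reward in an episode started at $s_0$ is at least $v^\star(s_0)-\delta$. Its query cost on a featurized MDP is the maximum over $s_0\in\mathcal S_0$ and over the $H$ calls of the expected number of queries in that call. The minimax query cost $\mathcal C^\star_{\mathrm{GA}}(\mathcal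 M,\delta)$ is the infimum, over planners that are $\delta$-sound for $\mathcal M$, of the supremum of the query cost over $\mathcal M$. **Theorem 1 (lower bound with global access, at least $\mathrm{poly}(d\wedge H)$ actions).** There are absolute constants $c>0$ and $d_0,H_0\in\mathbb N$ such that for all real $0<\delta\le 0.01$ and $B\ge 315$ and all integers $d\ge d_0$, $H\ge H_0$ and $A\ge \min(d^{1/4},H^{1/2})$, $$\mathcal C^\star_{\mathrm{GA}}(\mathcal M\cap\mathcal M^{\mathrm{Pdet}},\delta)\ \ge\ 2^{\,c\,\min(d^{1/4},\,H^{1/2})}$$ for each $\mathcal M\in\{\mathcal M^{v^\star}_{B,d,H,A},\ \mathcal M^{q^\star}_{B,d,H,A},\ \mathcal M^{v^\star/q^\star\,\mathrm{reach}}_{B,d,H,A}\}$. -/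

import Mathlib

open MeasureTheory ProbabilityTheory
open scoped ENNReal

noncomputable section

namespace OnlinePlanning

/-! ### Histories, randomized strategies and the law of an interaction -/

/-- Histories of `n` rounds. A history starts with an initial state; each round appends
a decision, a reward and a state. -/
@[reducible] def Hist (S D : Type) : ℕ → Type
  | 0 => S
  | n + 1 => Hist S D n × (D × (ℝ × S))

instance Hist.instMeasurableSpace (S D : Type) [MeasurableSpace S] [MeasurableSpace D] :
    (n : ℕ) → MeasurableSpace (Hist S D n)
  | 0 => inferInstanceAs (MeasurableSpace S)
  | n + 1 =>
    @Prod.instMeasurableSpace _ _ (Hist.instMeasurableSpace S D n)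
      (inferInstanceAs (MeasurableSpace (D × (ℝ × S))))

/-- A randomized strategy: after every history, a distribution of the next decision. -/
structure Strategy (S D : Type) [MeasurableSpace S] [MeasurableSpace D] where
  kernel : (n : ℕ) → Kernel (Hist S D n) D
  markov : ∀ n, IsMarkovKernel (kernel n)

/-- Law of the history of the first `n` rounds, started at `s`: in each round the decision is
drawn from the strategy and then the reward-state pair from the response kernel `env`. -/
def histLaw {S D : Type} [MeasurableSpace S] [MeasurableSpace D] (σ : Strategy S D)
    (env : (n : ℕ) → Kernel (Hist S D n × D) (ℝ × S)) (s : S) :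
    (n : ℕ) → Measure (Hist S D n)
  | 0 => Measure.dirac (α := S) s
  | n + 1 => (histLaw σ env s n) ⊗ₘ (σ.kernel n ⊗ₖ env n)

/-! ### Fixed-horizon Markov decision processes -/

/-- A finite state space split into stages `0, …, H`, where stage `H` consists of the single
final state `bot`. -/
structure StateSpace (H : ℕ) where
  State : Type
  finite : Finite State
  bot : State
  stage : State → ℕ
  stage_le : ∀ s, stage s ≤ H
  stage_eq_iff : ∀ s, stage s = H ↔ s = bot

instance {H : ℕ} (X : StateSpace H) : Finite X.State := X.finite

instance {H : ℕ} (X : StateSpace H) : MeasurableSpace X.State := ⊤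

instance {H : ℕ} (X : StateSpace H) : DiscreteMeasurableSpace X.State := ⟨fun _ => trivial⟩

/-- A fixed-horizon MDP with actions `Fin A`: `Q (s, a)` is the joint law of the reward and of
the next state. -/
structure MDP (H A : ℕ) where
  X : StateSpace H
  Q : Kernel (X.State × Fin A) (ℝ × X.State)
  markov : IsMarkovKernel Q
  supp : ∀ s, s ≠ X.bot → ∀ a, ∀ᵐ y ∂(Q (s, a)),
    y.1 ∈ Set.Icc (0 : ℝ) 1 ∧ (y.2 = X.bot ∨ X.stage y.2 = X.stage s + 1)
  supp_bot : ∀ a, ∀ᵐ y ∂(Q (X.bot, a)), y = (0, X.bot)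

/-! ### Policies and value functions -/

/-- Policies: stochastic kernels from histories `S₀, A₀, R₁, S₁, …, Sₜ` to actions. -/
abbrev Policy {H : ℕ} (X : StateSpace H) (A : ℕ) : Type := Strategy X.State (Fin A)

def lastState {S D : Type} : (n : ℕ) → Hist S D n → S
  | 0, s => s
  | _ + 1, h => h.2.2.2

theorem measurable_lastState {S D : Type} [MeasurableSpace S] [MeasurableSpace D] :
    (n : ℕ) → Measurable (lastState (S := S) (D := D) n)
  | 0 => measurable_id (α := S)
  | n + 1 => by
    have h : Measurable fun h : Hist S D n × (D × (ℝ × S)) => h.2.2.2 :=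
      measurable_snd.comp (measurable_snd.comp measurable_snd)
    exact h

/-- Sum of the (nonnegative) rewards in a history. -/
def totalReward {S D : Type} : (n : ℕ) → Hist S D n → ℝ≥0∞
  | 0, _ => 0
  | n + 1, h => totalReward n h.1 + ENNReal.ofReal h.2.2.1

/-- Environment of a policy: an action is applied to the current state. -/
def MDP.policyEnv {H A : ℕ} (M : MDP H A) (n : ℕ) :
    Kernel (Hist M.X.State (Fin A) n × Fin A) (ℝ × M.X.State) :=
  M.Q.comap (fun p => (lastState n p.1, p.2))
    (((measurable_lastState n).comp measurable_fst).prodMk measurable_snd)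

/-- `v^π(s)`: the total expected reward, as the limit of the increasing expectations of the
`n`-step partial sums. -/
def MDP.value {H A : ℕ} (M : MDP H A) (π : Policy M.X A) (s : M.X.State) : ℝ≥0∞ :=
  ⨆ n : ℕ, ∫⁻ h, totalReward n h ∂(histLaw π M.policyEnv s n)

/-- The policy that first takes `a` and then follows `π`. -/
def Policy.forceFirst {H A : ℕ} {X : StateSpace H} (π : Policy X A) (a : Fin A) :
    Policy X A where
  kernel
    | 0 => Kernel.const _ (Measure.dirac a)
    | n + 1 => π.kernel (n + 1)
  markov
    | 0 => inferInstanceAs (IsMarkovKernel (Kernel.const _ (Measure.dirac a)))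
    | n + 1 => π.markov (n + 1)

/-- `q^π(s, a)`. -/
def MDP.qValue {H A : ℕ} (M : MDP H A) (π : Policy M.X A) (s : M.X.State) (a : Fin A) :
    ℝ≥0∞ :=
  M.value (π.forceFirst a) s

/-- The optimal value function `v*`. -/
def MDP.vStar {H A : ℕ} (M : MDP H A) (s : M.X.State) : ℝ≥0∞ :=
  ⨆ π : Policy M.X A, M.value π s

/-- The optimal action-value function `q*`. -/
def MDP.qStar {H A : ℕ} (M : MDP H A) (s : M.X.State) (a : Fin A) : ℝ≥0∞ :=
  ⨆ π : Policy M.X A, M.qValue π s a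

/-- States reachable with positive probability from the initial states (those of stage `0`). -/
inductive MDP.Reachable {H A : ℕ} (M : MDP H A) : M.X.State → Prop
  | init (s : M.X.State) : M.X.stage s = 0 → M.Reachable s
  | step (s : M.X.State) (a : Fin A) (s' : M.X.State) :
      M.Reachable s → M.Q (s, a) {y | y.2 = s'} ≠ 0 → M.Reachable s'

/-- Deterministic transitions (the rewards may be random). -/
def MDP.DetTransitions {H A : ℕ} (M : MDP H A) : Prop :=
  ∀ s a, ∃ s', ∀ᵐ y ∂(M.Q (s, a)), y.2 = s'

/-! ### Featurized MDPs -/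

/-- State features. -/
abbrev FeatV (d : ℕ) (S : Type) : Type := S → EuclideanSpace ℝ (Fin d)

/-- State-action features. -/
abbrev FeatQ (d A : ℕ) (S : Type) : Type := S → Fin A → EuclideanSpace ℝ (Fin d)

/-- Both kinds of features. -/
abbrev FeatVQ (d A : ℕ) (S : Type) : Type := FeatV d S × FeatQ d A S

/-- An MDP with features, whose kind is given by `F`. -/
structure FMDP (H A : ℕ) (F : Type → Type) where
  M : MDP H A
  φ : F M.X.State

/-- The `v*`-realizable class. -/
def classV (B : ℝ) (d H A : ℕ) : Set (FMDP H A (FeatV d)) :=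
  {N | (∀ s, ‖N.φ s‖ ≤ 1) ∧
    ∃ θ : EuclideanSpace ℝ (Fin d), ‖θ‖ ≤ B ∧
      ∀ s, (N.M.vStar s).toReal = inner ℝ (N.φ s) θ}

/-- The `q*`-realizable class. -/
def classQ (B : ℝ) (d H A : ℕ) : Set (FMDP H A (FeatQ d A)) :=
  {N | (∀ s a, ‖N.φ s a‖ ≤ 1) ∧
    ∃ θ : EuclideanSpace ℝ (Fin d), ‖θ‖ ≤ B ∧
      ∀ s a, (N.M.qStar s a).toReal = inner ℝ (N.φ s a) θ}

/-- The reachable-`v*`/`q*`-realizable class. -/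
def classReach (B : ℝ) (d H A : ℕ) : Set (FMDP H A (FeatVQ d A)) :=
  {N | (∀ s, ‖N.φ.1 s‖ ≤ 1) ∧ (∀ s a, ‖N.φ.2 s a‖ ≤ 1) ∧
    ∃ θ : EuclideanSpace ℝ (Fin d), ‖θ‖ ≤ B ∧
      ∀ s, N.M.Reachable s →
        (N.M.vStar s).toReal = inner ℝ (N.φ.1 s) θ ∧
        ∀ a, (N.M.qStar s a).toReal = inner ℝ (N.φ.2 s a) θ}

/-- Featurized MDPs with deterministic transitions. -/
def classPdet (H A : ℕ) (F : Type → Type) : Set (FMDP H A F) :=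
  {N | N.M.DetTransitions}

/-! ### Online planning with global access -/

/-- Decisions of a planner: `Sum.inl (s, a)` queries the simulator at `(s, a)`, and
`Sum.inr a` ends the current call and returns the action `a`. -/
abbrev Move (S : Type) (A : ℕ) : Type := (S × Fin A) ⊕ Fin A

instance {S : Type} {A : ℕ} [MeasurableSpace S] [DiscreteMeasurableSpace S] [Finite S] :
    DiscreteMeasurableSpace (Move S A) where
  forall_measurableSet _ :=
    measurableSet_sum_iff.2 ⟨MeasurableSet.of_discrete, MeasurableSet.of_discrete⟩

/-- The state-action pair to which a decision applies, given the current state `s`. -/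
def Move.target {S : Type} {A : ℕ} : Move S A → S → S × Fin A
  | .inl p, _ => p
  | .inr a, s => (s, a)

/-- The current state after a decision; `s` is the state before it, `s'` the drawn state. -/
def Move.next {S : Type} {A : ℕ} : Move S A → S → S → S
  | .inl _, s, _ => s
  | .inr _, _, s' => s'

/-- The current state of the episode. -/
def curState {S : Type} {A : ℕ} : (n : ℕ) → Hist S (Move S A) n → S
  | 0, s => s
  | n + 1, h => Move.next h.2.1 (curState n h.1) h.2.2.2

theorem measurable_curState {S : Type} [MeasurableSpace S] [DiscreteMeasurableSpace S]
    [Finite S] {A : ℕ} : (n : ℕ) → Measurable (curState (S := S) (A := A) n)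
  | 0 => measurable_id (α := S)
  | n + 1 => by
    have hf : Measurable fun p : Move S A × (S × S) => Move.next p.1 p.2.1 p.2.2 :=
      Measurable.of_discrete
    have h : Measurable fun h : Hist S (Move S A) n × (Move S A × (ℝ × S)) =>
        (h.2.1, (curState n h.1, h.2.2.2)) :=
      (measurable_fst.comp measurable_snd).prodMk
        (((measurable_curState n).comp measurable_fst).prodMk
          (measurable_snd.comp (measurable_snd.comp measurable_snd)))
    exact hf.comp h

/-- Number of completed calls, that is, the index of the current call. -/
def callIndex {S : Type} {A : ℕ} : (n : ℕ) → Hist S (Move S A) n → ℕ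
  | 0, _ => 0
  | n + 1, h =>
    match h.2.1 with
    | .inl _ => callIndex n h.1
    | .inr _ => callIndex n h.1 + 1

/-- Reward collected in the episode (the responses to queries do not count). -/
def episodeReward {S : Type} {A : ℕ} : (n : ℕ) → Hist S (Move S A) n → ℝ≥0∞
  | 0, _ => 0
  | n + 1, h =>
    match h.2.1 with
    | .inl _ => episodeReward n h.1
    | .inr _ => episodeReward n h.1 + ENNReal.ofReal h.2.2.1

/-- Number of queries made during call `t`. -/
def queriesInCall {S : Type} {A : ℕ} (t : ℕ) : (n : ℕ) → Hist S (Move S A) n → ℝ≥0∞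
  | 0, _ => 0
  | n + 1, h =>
    match h.2.1 with
    | .inl _ => queriesInCall t n h.1 + if callIndex n h.1 = t then 1 else 0
    | .inr _ => queriesInCall t n h.1

/-- Environment of a planner: queries are answered by the simulator, and returned actions move
the episode; both responses are drawn from `Q`. -/
def MDP.plannerEnv {H A : ℕ} (M : MDP H A) (n : ℕ) :
    Kernel (Hist M.X.State (Move M.X.State A) n × Move M.X.State A) (ℝ × M.X.State) :=
  M.Q.comap (fun p => Move.target p.2 (curState n p.1))
    ((Measurable.of_discrete
        (f := fun p : Move M.X.State A × M.X.State => Move.target p.1 p.2)).comp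
      (measurable_snd.prodMk ((measurable_curState n).comp measurable_fst)))

/-- A planner with global access: it is given the whole state space and feature-map (but not
the kernel `Q`) and then decides, at random, on the basis of everything that happened so far. -/
def Planner (H A : ℕ) (F : Type → Type) : Type 1 :=
  (X : StateSpace H) → F X.State → Strategy X.State (Move X.State A)

/-- Law of the first `n` rounds of the interaction in an episode started at `s`. -/
def Planner.law {H A : ℕ} {F : Type → Type} (P : Planner H A F) (N : FMDP H A F)
    (s : N.M.X.State) (n : ℕ) : Measure (Hist N.M.X.State (Move N.M.X.State A) n) :=
  histLaw (P N.M.X N.φ) N.M.plannerEnv s n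

/-- Expected total reward achieved by the planner in an episode started at `s`. -/
def Planner.value {H A : ℕ} {F : Type → Type} (P : Planner H A F) (N : FMDP H A F)
    (s : N.M.X.State) : ℝ≥0∞ :=
  ⨆ n : ℕ, ∫⁻ h, episodeReward n h ∂(P.law N s n)

/-- `δ`-soundness on a class of featurized MDPs. -/
def Planner.Sound {H A : ℕ} {F : Type → Type} (P : Planner H A F) (𝓜 : Set (FMDP H A F))
    (δ : ℝ) : Prop :=
  ∀ N ∈ 𝓜, ∀ s, N.M.X.stage s = 0 → N.M.vStar s ≤ P.value N s + ENNReal.ofReal δ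

/-- Worst-case query cost: the largest expected number of queries in one of the `H` calls of an
episode, over the initial states and the calls. -/
def Planner.queryCost {H A : ℕ} {F : Type → Type} (P : Planner H A F) (N : FMDP H A F) :
    ℝ≥0∞ :=
  ⨆ (s : N.M.X.State) (_ : N.M.X.stage s = 0) (t : Fin H) (n : ℕ),
    ∫⁻ h, queriesInCall (t : ℕ) n h ∂(P.law N s n)

/-- The minimax query cost with global access. -/
def queryComplexity {H A : ℕ} {F : Type → Type} (𝓜 : Set (FMDP H A F)) (δ : ℝ) : ℝ≥0∞ :=
  ⨅ (P : Planner H A F) (_ : P.Sound 𝓜 δ), ⨆ N ∈ 𝓜, P.queryCost N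

end OnlinePlanning

end

/-!
The lower bound hides a secret vertex `u` of the cube `{0, 1} ^ p`, with `p` close to
`min (d ^ (1/4)) (H ^ (1/2))`, in a game of `p` phases. In a phase that starts at the vertex `w`,
the player flips a set of at least `p / 4` bits, one per action, and then ends the phase at the
vertex reached. The states of the MDP are the sequences of actions, so that transitions are
deterministic and everything but `u` is known to the planner.

*Values.* Let `h x = 1 - x + x ^ 2 / 2` (`decay`), let `c` be the product of `h (|Fᵢ| / p)` over
the flip sets `Fᵢ` of the completed phases, and let `F` be the flip set of the current phase. With
`E = w ∆ u`, the value is `c * h (|F ∪ E| / p) * h (|F \ E| / p)`. It never increases, and some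
action preserves it as long as `w` is at distance at least `p / 4` from `u`: flip a bit of `E \ F`,
or end the phase if there is none (`Conf.value_step_le`, `Conf.exists_value_step_eq`). That ending
a phase early does not pay is the log-convexity of `h` (`decay_mul_le`). So this is the optimal
value if the game is stopped, with a Bernoulli reward of mean equal to the value, as soon as a
phase ends at distance less than `p / 4` from `u`, or after `p` phases. As both cardinalities are
affine in `u` and `h` is quadratic, the value is linear in tensors of order four over `p + 1`
affine coordinates (`inner_confFeature`). Constraints on the states visited after the game should
have stopped are void, because rewards can be chosen freely there; this is how realizability in
all states is obtained, with one choice for `v*` (`statePayoff`) and another for `q*`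
(`actionPayoff`), and for the latter both functions are realized on the reachable states.

*Hiding.* Since `h` is at most `25 / 32` on `[1/4, 1]`, the reward after `p` far phases has mean at
most `(25 / 32) ^ p`. Every query therefore looks like one to a reward-free model that does not
depend on `u`, unless the sequence queried has visited a vertex close to `u`, which happens for an
exponentially small fraction of the `u` (`card_close_le`), or an exponentially unlikely reward
occurs. As long as nothing is revealed, the law of the interaction is dominated by its law in the
reward-free model (`lintegral_unrevealing_le`), so that the probabilities of a revelation can be
summed over `u` (`sum_measure_not_unrevealing_le`). An unrevealing episode is over after
`p * (p + 1)` calls without any reward, whatever `H` is, and Markov's inequality bounds the number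
of rounds these calls take (`iSup_episodeReward_le`, `mul_measure_callIndex_lt_le`). A planner with
too few queries thus misses, for some `u`, an initial value of at least `1 / 2`.
-/

noncomputable section

namespace OnlinePlanning

open scoped symmDiff

/-! ### Integration against the law of an interaction -/

section Law

variable {S D : Type} [MeasurableSpace S] [MeasurableSpace D]

instance (σ : Strategy S D) (n : ℕ) : IsMarkovKernel (σ.kernel n) := σ.markov n

theorem isProbabilityMeasure_histLaw (σ : Strategy S D)
    (env : (n : ℕ) → Kernel (Hist S D n × D) (ℝ × S)) [∀ n, IsMarkovKernel (env n)] (s : S) :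
    ∀ n, IsProbabilityMeasure (histLaw σ env s n)
  | 0 => inferInstanceAs (IsProbabilityMeasure (Measure.dirac (α := S) s))
  | n + 1 => by
    have := isProbabilityMeasure_histLaw σ env s n
    exact inferInstanceAs
      (IsProbabilityMeasure ((histLaw σ env s n) ⊗ₘ (σ.kernel n ⊗ₖ env n)))

theorem lintegral_histLaw_zero (σ : Strategy S D)
    (env : (n : ℕ) → Kernel (Hist S D n × D) (ℝ × S)) (s : S)
    (f : S → ℝ≥0∞) (hf : Measurable f) :
    ∫⁻ h, f h ∂(histLaw σ env s 0) = f s :=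
  lintegral_dirac' (α := S) s hf

theorem lintegral_histLaw_succ (σ : Strategy S D)
    (env : (n : ℕ) → Kernel (Hist S D n × D) (ℝ × S)) [∀ n, IsMarkovKernel (env n)] (s : S)
    (n : ℕ) (f : Hist S D n × (D × (ℝ × S)) → ℝ≥0∞) (hf : Measurable f) :
    ∫⁻ h, f h ∂(histLaw σ env s (n + 1)) =
      ∫⁻ h, ∫⁻ a, ∫⁻ y, f (h, (a, y)) ∂(env n (h, a)) ∂(σ.kernel n h) ∂(histLaw σ env s n) := by
  have := isProbabilityMeasure_histLaw σ env s n
  change ∫⁻ h, f h ∂((histLaw σ env s n) ⊗ₘ (σ.kernel n ⊗ₖ env n)) = _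
  rw [Measure.lintegral_compProd hf]
  refine lintegral_congr fun h => ?_
  exact Kernel.lintegral_compProd _ _ _ (hf.comp measurable_prodMk_left)

theorem measurable_totalReward : (n : ℕ) → Measurable (totalReward (S := S) (D := D) n)
  | 0 => measurable_const
  | n + 1 => by
    have h : Measurable fun h : Hist S D n × (D × (ℝ × S)) =>
        totalReward n h.1 + ENNReal.ofReal h.2.2.1 :=
      ((measurable_totalReward n).comp measurable_fst).add
        (ENNReal.measurable_ofReal.comp
          (measurable_fst.comp (measurable_snd.comp measurable_snd)))
    exact h

end Law

/-! ### Dynamic programming -/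

section Bellman

variable {H A : ℕ} (M : MDP H A)

instance : IsMarkovKernel M.Q := M.markov

instance (n : ℕ) : IsMarkovKernel (M.policyEnv n) := by
  unfold MDP.policyEnv; infer_instance

/-- The right-hand side of the Bellman equation for the value function `V`. -/
def MDP.backup (V : M.X.State → ℝ≥0∞) (s : M.X.State) (a : Fin A) : ℝ≥0∞ :=
  ∫⁻ y, ENNReal.ofReal y.1 + V y.2 ∂(M.Q (s, a))

/-- Expected reward of the first `n` steps plus the value `V` of the state reached. -/
def MDP.potential (σ : Policy M.X A) (V : M.X.State → ℝ≥0∞) (s : M.X.State) (n : ℕ) : ℝ≥0∞ :=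
  ∫⁻ h, totalReward n h + V (lastState n h) ∂(histLaw σ M.policyEnv s n)

theorem MDP.potential_zero (σ : Policy M.X A) (V : M.X.State → ℝ≥0∞) (s : M.X.State) :
    M.potential σ V s 0 = V s := by
  have h := lintegral_histLaw_zero σ M.policyEnv s (fun s => (0 : ℝ≥0∞) + V s)
    Measurable.of_discrete
  rw [zero_add] at h
  exact h

theorem MDP.potential_succ (σ : Policy M.X A) (V : M.X.State → ℝ≥0∞) (s : M.X.State) (n : ℕ) :
    M.potential σ V s (n + 1) =
      ∫⁻ h, totalReward n h + ∫⁻ a, M.backup V (lastState n h) a ∂(σ.kernel n h)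
        ∂(histLaw σ M.policyEnv s n) := by
  have hV : Measurable V := Measurable.of_discrete
  have hm : Measurable fun y : ℝ × M.X.State => ENNReal.ofReal y.1 + V y.2 :=
    (ENNReal.measurable_ofReal.comp measurable_fst).add (hV.comp measurable_snd)
  have h := lintegral_histLaw_succ σ M.policyEnv s n
    (fun h => totalReward n h.1 + ENNReal.ofReal h.2.2.1 + V h.2.2.2)
    ((((measurable_totalReward n).comp measurable_fst).add
      (ENNReal.measurable_ofReal.comp
          (measurable_fst.comp (measurable_snd.comp measurable_snd)))).add
      (hV.comp (measurable_snd.comp (measurable_snd.comp measurable_snd))))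
  refine Eq.trans h (lintegral_congr fun h => ?_)
  have h2 : ∀ a, ∫⁻ y, totalReward n h + ENNReal.ofReal y.1 + V y.2 ∂(M.policyEnv n (h, a)) =
      totalReward n h + M.backup V (lastState n h) a := by
    intro a
    simp_rw [add_assoc]
    rw [lintegral_add_left measurable_const, lintegral_const, measure_univ, mul_one]
    rfl
  simp only [h2]
  rw [lintegral_add_left measurable_const, lintegral_const, measure_univ, mul_one]

theorem MDP.potential_succ_le (σ : Policy M.X A) (V : M.X.State → ℝ≥0∞)
    (hV : ∀ s a, M.backup V s a ≤ V s) (s : M.X.State) (n : ℕ) :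
    M.potential σ V s (n + 1) ≤ M.potential σ V s n := by
  rw [M.potential_succ]
  refine lintegral_mono fun h => ?_
  gcongr
  calc ∫⁻ a, M.backup V (lastState n h) a ∂(σ.kernel n h)
      ≤ ∫⁻ _, V (lastState n h) ∂(σ.kernel n h) := lintegral_mono fun a => hV _ a
    _ = V (lastState n h) := by rw [lintegral_const, measure_univ, mul_one]

/-- The state after `n` steps is the final one or has stage `n` more than the initial one. -/
theorem MDP.lintegral_stage_eq_zero (σ : Policy M.X A) (s : M.X.State) (n : ℕ) :
    ∫⁻ h, {x : M.X.State | ¬ (x = M.X.bot ∨ M.X.stage x = M.X.stage s + n)}.indicator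
      (fun _ => (1 : ℝ≥0∞)) (lastState n h) ∂(histLaw σ M.policyEnv s n) = 0 := by
  induction n with
  | zero =>
    refine (lintegral_histLaw_zero σ M.policyEnv s _ Measurable.of_discrete).trans ?_
    exact Set.indicator_of_notMem (by exact not_not.2 (Or.inr rfl)) _
  | succ n ih =>
    refine le_antisymm ?_ bot_le
    rw [← ih]
    have hI : ∀ s : Set M.X.State, Measurable (s.indicator (fun _ => (1 : ℝ≥0∞))) :=
      fun s => Measurable.of_discrete
    refine (lintegral_histLaw_succ σ M.policyEnv s n _
      ((hI _).comp (measurable_snd.comp (measurable_snd.comp measurable_snd)))).trans_le ?_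
    refine lintegral_mono fun h => ?_
    by_cases hs : lastState n h = M.X.bot ∨
        M.X.stage (lastState n h) = M.X.stage s + n
    · refine le_trans (le_of_eq (lintegral_eq_zero_of_ae_eq_zero ?_)) bot_le
      refine Filter.Eventually.of_forall fun a => ?_
      refine lintegral_eq_zero_of_ae_eq_zero ?_
      have : ∀ᵐ y ∂(M.Q (lastState n h, a)), y.2 = M.X.bot ∨
          M.X.stage y.2 = M.X.stage s + (n + 1) := by
        by_cases hb : lastState n h = M.X.bot
        · rw [hb]
          filter_upwards [M.supp_bot a] with y hy
          exact Or.inl (by rw [hy])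
        · filter_upwards [M.supp _ hb a] with y hy
          rcases hy.2 with h1 | h1
          · exact Or.inl h1
          · exact Or.inr (by rw [h1, hs.resolve_left hb]; ring)
      refine Filter.Eventually.mono this fun y hy => ?_
      exact Set.indicator_of_notMem (by exact not_not.2 hy) _
    · have h1 : {x : M.X.State | ¬ (x = M.X.bot ∨ M.X.stage x = M.X.stage s + n)}.indicator
          (fun _ => (1 : ℝ≥0∞)) (lastState n h) = 1 := Set.indicator_of_mem hs _
      rw [h1]
      calc _ ≤ ∫⁻ a, ∫⁻ y, 1 ∂(M.policyEnv n (h, a)) ∂(σ.kernel n h) :=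
            lintegral_mono fun a => lintegral_mono fun y =>
              Set.indicator_le_self' (f := fun _ : M.X.State => (1 : ℝ≥0∞)) (by simp) _
        _ = 1 := by simp

/-- At the horizon the final state is reached, so that the potential consists of rewards only. -/
theorem MDP.potential_horizon_le_value (σ : Policy M.X A) (V : M.X.State → ℝ≥0∞)
    (hbot : V M.X.bot = 0) (s : M.X.State) :
    M.potential σ V s H ≤ M.value σ s := by
  refine le_trans ?_ (le_iSup (fun n => ∫⁻ h, totalReward n h ∂(histLaw σ M.policyEnv s n)) H)
  have hV : Measurable V := Measurable.of_discrete
  unfold MDP.potential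
  rw [lintegral_add_left (measurable_totalReward H)]
  have hz := M.lintegral_stage_eq_zero σ s H
  rw [lintegral_eq_zero_iff] at hz
  · rw [lintegral_eq_zero_of_ae_eq_zero (f := fun h => V (lastState H h)), add_zero]
    filter_upwards [hz] with h hh
    have h1 : lastState H h = M.X.bot := by
      by_contra hne
      have h2 : M.X.stage (lastState H h) ≠ H := fun h => hne ((M.X.stage_eq_iff _).1 h)
      have h3 := M.X.stage_le (lastState H h)
      rw [Set.indicator_of_mem] at hh
      · simp at hh
      · rintro (h4 | h4)
        · exact hne h4
        · omega
    simp [h1, hbot]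
  · exact Measurable.comp (Measurable.of_discrete (f := Set.indicator _ _))
      (measurable_lastState H)

/-- The policy that applies `g` to the current state. -/
def greedyPolicy {X : StateSpace H} (g : X.State → Fin A) : Policy X A where
  kernel n := Kernel.deterministic (fun h => g (lastState n h))
    ((Measurable.of_discrete (f := g)).comp (measurable_lastState n))
  markov _ := inferInstance

theorem MDP.potential_succ_greedy (σ : Policy M.X A) (V : M.X.State → ℝ≥0∞)
    (g : M.X.State → Fin A) (hg : ∀ s, M.backup V s (g s) = V s) (n : ℕ)
    (hσ : σ.kernel n = (greedyPolicy g).kernel n) (s : M.X.State) :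
    M.potential σ V s (n + 1) = M.potential σ V s n := by
  rw [M.potential_succ, hσ]
  refine lintegral_congr fun h => ?_
  simp only [greedyPolicy, Kernel.deterministic_apply]
  rw [lintegral_dirac' _ Measurable.of_discrete, hg]

theorem MDP.value_le_of_potential (σ : Policy M.X A) (V : M.X.State → ℝ≥0∞) (s : M.X.State)
    (C : ℝ≥0∞) (h : ∀ n, M.potential σ V s (n + 1) ≤ C) : M.value σ s ≤ C := by
  refine iSup_le fun n => ?_
  cases n with
  | zero => exact (lintegral_histLaw_zero σ M.policyEnv s _ measurable_const).trans_le bot_le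
  | succ n => exact le_trans (lintegral_mono fun h => le_self_add) (h n)

/-- A solution of the Bellman optimality equation is the optimal value function. -/
theorem MDP.vStar_eq (V : M.X.State → ℝ≥0∞) (hbot : V M.X.bot = 0)
    (hV : ∀ s a, M.backup V s a ≤ V s) (hV' : ∀ s, ∃ a, M.backup V s a = V s)
    (s : M.X.State) : M.vStar s = V s := by
  apply le_antisymm
  · refine iSup_le fun π => M.value_le_of_potential π V s _ fun n => ?_
    have : ∀ n, M.potential π V s n ≤ V s := by
      intro n
      induction n with
      | zero => rw [M.potential_zero]
      | succ n ih => exact (M.potential_succ_le π V hV s n).trans ih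
    exact this _
  · choose g hg using hV'
    refine le_trans ?_ (le_iSup (fun π => M.value π s) (greedyPolicy g))
    have : ∀ n, M.potential (greedyPolicy g) V s n = V s := by
      intro n
      induction n with
      | zero => rw [M.potential_zero]
      | succ n ih => rw [M.potential_succ_greedy _ V g hg n rfl, ih]
    rw [← this H]
    exact M.potential_horizon_le_value _ V hbot s

theorem MDP.potential_one_forceFirst (π : Policy M.X A) (a : Fin A) (V : M.X.State → ℝ≥0∞)
    (s : M.X.State) : M.potential (π.forceFirst a) V s 1 = M.backup V s a := by
  rw [M.potential_succ]
  refine (lintegral_histLaw_zero _ M.policyEnv s (fun s => (0 : ℝ≥0∞) +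
    ∫⁻ a, M.backup V s a ∂((π.forceFirst a).kernel 0 s)) Measurable.of_discrete).trans ?_
  rw [zero_add]
  simp only [Policy.forceFirst, Kernel.const_apply]
  rw [lintegral_dirac' _ Measurable.of_discrete]

theorem MDP.qStar_eq (hH : 0 < H) (V : M.X.State → ℝ≥0∞) (hbot : V M.X.bot = 0)
    (hV : ∀ s a, M.backup V s a ≤ V s) (hV' : ∀ s, ∃ a, M.backup V s a = V s)
    (s : M.X.State) (a : Fin A) : M.qStar s a = M.backup V s a := by
  apply le_antisymm
  · refine iSup_le fun π => M.value_le_of_potential _ V s _ fun n => ?_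
    induction n with
    | zero => rw [M.potential_one_forceFirst]
    | succ n ih => exact (M.potential_succ_le _ V hV s _).trans ih
  · choose g hg using hV'
    refine le_trans ?_ (le_iSup (fun π => M.qValue π s a) (greedyPolicy g))
    have : ∀ n, M.potential (Policy.forceFirst (greedyPolicy g) a) V s (n + 1) =
        M.backup V s a := by
      intro n
      induction n with
      | zero => rw [M.potential_one_forceFirst]
      | succ n ih => rw [M.potential_succ_greedy (Policy.forceFirst (greedyPolicy g) a) V g hg (n + 1) rfl, ih]
    obtain ⟨k, rfl⟩ := Nat.exists_eq_succ_of_ne_zero hH.ne'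
    rw [← this k]
    exact M.potential_horizon_le_value _ V hbot s

end Bellman

/-! ### Deterministic transitions with Bernoulli rewards -/

/-- Transition and reward functions of an MDP in which action `a` in state `s` leads to
`next s a` and has a Bernoulli reward of mean `rew s a`. A nonzero mean reward is only allowed
on transitions into the final state, so that an episode has at most one nonzero reward. -/
structure DetModel {H : ℕ} (X : StateSpace H) (A : ℕ) where
  next : X.State → Fin A → X.State
  rew : X.State → Fin A → ℝ
  rew_mem : ∀ s a, rew s a ∈ Set.Icc (0 : ℝ) 1
  next_stage : ∀ s, s ≠ X.bot → ∀ a, next s a = X.bot ∨ X.stage (next s a) = X.stage s + 1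
  next_bot : ∀ a, next X.bot a = X.bot
  rew_bot : ∀ a, rew X.bot a = 0
  next_of_rew : ∀ s a, rew s a ≠ 0 → next s a = X.bot

namespace DetModel

variable {H A : ℕ} {X : StateSpace H} (m : DetModel X A)

/-- The joint law of reward and next state. -/
def law (p : X.State × Fin A) : Measure (ℝ × X.State) :=
  ENNReal.ofReal (m.rew p.1 p.2) • Measure.dirac (1, m.next p.1 p.2) +
    ENNReal.ofReal (1 - m.rew p.1 p.2) • Measure.dirac (0, m.next p.1 p.2)

theorem lintegral_law (p : X.State × Fin A) (f : ℝ × X.State → ℝ≥0∞) :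
    ∫⁻ y, f y ∂(m.law p) = ENNReal.ofReal (m.rew p.1 p.2) * f (1, m.next p.1 p.2) +
      ENNReal.ofReal (1 - m.rew p.1 p.2) * f (0, m.next p.1 p.2) := by
  rw [law, lintegral_add_measure, lintegral_smul_measure, lintegral_smul_measure,
    lintegral_dirac, lintegral_dirac, smul_eq_mul, smul_eq_mul]

theorem ofReal_rew_add (s : X.State) (a : Fin A) :
    ENNReal.ofReal (m.rew s a) + ENNReal.ofReal (1 - m.rew s a) = 1 := by
  rw [← ENNReal.ofReal_add (m.rew_mem s a).1 (sub_nonneg.2 (m.rew_mem s a).2)]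
  simp

theorem ae_law {p : X.State × Fin A} {P : ℝ × X.State → Prop}
    (h1 : m.rew p.1 p.2 ≠ 0 → P (1, m.next p.1 p.2)) (h0 : P (0, m.next p.1 p.2)) :
    ∀ᵐ y ∂(m.law p), P y := by
  rw [law, ae_add_measure_iff]
  constructor
  · by_cases hr : m.rew p.1 p.2 = 0
    · simp [hr]
    · refine Measure.ae_smul_measure ?_ _
      rw [ae_dirac_eq]
      exact h1 hr
  · refine Measure.ae_smul_measure ?_ _
    rw [ae_dirac_eq]
    exact h0

/-- The transition kernel. -/
def kernel : Kernel (X.State × Fin A) (ℝ × X.State) :=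
  ⟨m.law, Measurable.of_discrete⟩

instance : IsMarkovKernel m.kernel where
  isProbabilityMeasure p := by
    refine ⟨?_⟩
    have h := m.lintegral_law p (fun _ => 1)
    rw [lintegral_one, mul_one, mul_one, m.ofReal_rew_add] at h
    exact h

/-- The MDP of a model. -/
@[reducible] def toMDP : MDP H A where
  X := X
  Q := m.kernel
  markov := inferInstance
  supp s hs a := m.ae_law (p := (s, a)) (fun _ => ⟨by simp, m.next_stage s hs a⟩)
    ⟨by simp, m.next_stage s hs a⟩
  supp_bot a := m.ae_law (p := (X.bot, a)) (fun h => absurd (m.rew_bot a) h)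
    (by simp [m.next_bot])

theorem detTransitions : m.toMDP.DetTransitions := fun s a =>
  ⟨m.next s a, m.ae_law (p := (s, a)) (fun _ => rfl) rfl⟩

theorem backup_toMDP (V : X.State → ℝ≥0∞) (s : X.State) (a : Fin A) :
    m.toMDP.backup V s a = ENNReal.ofReal (m.rew s a) + V (m.next s a) := by
  refine (m.lintegral_law (s, a) (fun y => ENNReal.ofReal y.1 + V y.2)).trans ?_
  simp only [ENNReal.ofReal_one, ENNReal.ofReal_zero, zero_add]
  rw [mul_add, mul_one, add_assoc, ← add_mul, m.ofReal_rew_add, one_mul]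

theorem next_eq_of_reach {s s' : X.State} {a : Fin A}
    (h : m.toMDP.Q (s, a) {y | y.2 = s'} ≠ 0) : s' = m.next s a := by
  by_contra hne
  refine h ?_
  have : ∀ᵐ y ∂(m.law (s, a)), ¬ y.2 = s' :=
    m.ae_law (fun _ => fun h => hne h.symm) (fun h => hne h.symm)
  rw [ae_iff] at this
  simp only [not_not] at this
  exact this

theorem reachable_induction {P : X.State → Prop} (h0 : ∀ s, X.stage s = 0 → P s)
    (hs : ∀ s a, P s → P (m.next s a)) {s : X.State} (h : m.toMDP.Reachable s) : P s := by
  have key : ∀ s : m.toMDP.X.State, m.toMDP.Reachable s → P s := by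
    intro s h
    induction h with
    | init s h => exact h0 s h
    | step s a s' _ hQ ih =>
      rw [m.next_eq_of_reach hQ]
      exact hs s a ih
  exact key s h

end DetModel

/-! ### The interaction of a planner with the simulator -/

section Planning

variable {H A : ℕ} {X : StateSpace H}

/-- The environment of a planner, as a function of the transition kernel alone. -/
def queryEnv (Q : Kernel (X.State × Fin A) (ℝ × X.State)) (n : ℕ) :
    Kernel (Hist X.State (Move X.State A) n × Move X.State A) (ℝ × X.State) :=
  Q.comap (fun p => Move.target p.2 (curState n p.1))
    ((Measurable.of_discrete
        (f := fun p : Move X.State A × X.State => Move.target p.1 p.2)).comp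
      (measurable_snd.prodMk ((measurable_curState n).comp measurable_fst)))

instance (Q : Kernel (X.State × Fin A) (ℝ × X.State)) [IsMarkovKernel Q] (n : ℕ) :
    IsMarkovKernel (queryEnv Q n) := by
  unfold queryEnv; infer_instance

theorem measurable_target (n : ℕ) :
    Measurable fun q : Hist X.State (Move X.State A) n × Move X.State A =>
      Move.target q.2 (curState n q.1) :=
  (Measurable.of_discrete
    (f := fun p : Move X.State A × X.State => Move.target p.1 p.2)).comp
      (measurable_snd.prodMk ((measurable_curState n).comp measurable_fst))

theorem lintegral_queryEnv_succ (σ : Strategy X.State (Move X.State A))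
    (Q : Kernel (X.State × Fin A) (ℝ × X.State)) [IsMarkovKernel Q] (s : X.State) (n : ℕ)
    (f : Hist X.State (Move X.State A) (n + 1) → ℝ≥0∞) (hf : Measurable f) :
    ∫⁻ h, f h ∂(histLaw σ (queryEnv Q) s (n + 1)) =
      ∫⁻ h, ∫⁻ D, ∫⁻ y, f (h, (D, y)) ∂(Q (Move.target D (curState n h)))
        ∂(σ.kernel n h) ∂(histLaw σ (queryEnv Q) s n) :=
  lintegral_histLaw_succ σ (queryEnv Q) s n f hf

/-! ### Indistinguishability from a reference model without rewards -/

/-- Histories from `s` in which every response is `(0, next s a)`, the one of a reward-free model with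
transition function `next`. -/
def Unrevealing (next : X.State → Fin A → X.State) (s : X.State) :
    (n : ℕ) → Set (Hist X.State (Move X.State A) n)
  | 0 => ({s} : Set X.State)
  | n + 1 => {h | h.1 ∈ Unrevealing next s n ∧
      h.2.2 = (0, Function.uncurry next (Move.target h.2.1 (curState n h.1)))}

theorem measurableSet_unrevealing (next : X.State → Fin A → X.State) (s : X.State) :
    (n : ℕ) → MeasurableSet (Unrevealing (A := A) next s n)
  | 0 => measurableSet_singleton (α := X.State) s
  | n + 1 => by
    have h1 : Measurable fun h : Hist X.State (Move X.State A) n ×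
        (Move X.State A × (ℝ × X.State)) => h.1 := measurable_fst
    have h2 : Measurable fun h : Hist X.State (Move X.State A) n ×
        (Move X.State A × (ℝ × X.State)) =>
        ((0 : ℝ), Function.uncurry next (Move.target h.2.1 (curState n h.1))) :=
      measurable_const.prodMk ((Measurable.of_discrete (f := Function.uncurry next)).comp
        ((measurable_target n).comp (measurable_fst.prodMk
          (measurable_fst.comp measurable_snd))))
    exact (h1 (measurableSet_unrevealing next s n)).inter
      (measurableSet_eq_fun (measurable_snd.comp measurable_snd) h2)

/-- The kernel of the reward-free model with transition function `next`. -/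
def nullKernel (next : X.State → Fin A → X.State) :
    Kernel (X.State × Fin A) (ℝ × X.State) :=
  Kernel.deterministic (fun p => (0, Function.uncurry next p)) Measurable.of_discrete

instance (next : X.State → Fin A → X.State) : IsMarkovKernel (nullKernel next) := by
  unfold nullKernel; infer_instance

/-- The probability that a response differs from that of the reward-free model. -/
def revealProb (Q : Kernel (X.State × Fin A) (ℝ × X.State)) (next : X.State → Fin A → X.State)
    (p : X.State × Fin A) : ℝ≥0∞ :=
  Q p {(0, Function.uncurry next p)}ᶜ

/-- On unrevealing histories, the law of the interaction is dominated by its law in the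
reward-free model. -/
theorem lintegral_unrevealing_le (σ : Strategy X.State (Move X.State A))
    (Q : Kernel (X.State × Fin A) (ℝ × X.State)) [IsMarkovKernel Q]
    (next : X.State → Fin A → X.State) (s : X.State) (n : ℕ)
    (f : Hist X.State (Move X.State A) n → ℝ≥0∞) (hf : Measurable f) :
    ∫⁻ h, (Unrevealing next s n).indicator f h ∂(histLaw σ (queryEnv Q) s n) ≤
      ∫⁻ h, f h ∂(histLaw σ (queryEnv (nullKernel next)) s n) := by
  induction n with
  | zero => exact lintegral_mono fun h => Set.indicator_le_self _ _ _
  | succ n ih =>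
    rw [lintegral_queryEnv_succ σ Q s n _ (hf.indicator (measurableSet_unrevealing next s (n + 1))),
      lintegral_queryEnv_succ σ _ s n _ hf]
    set g : Hist X.State (Move X.State A) n → ℝ≥0∞ := fun h =>
      ∫⁻ D, f (h, (D, (0, Function.uncurry next (Move.target D (curState n h)))))
        ∂(σ.kernel n h) with hg
    have hgm : Measurable g := by
      refine Measurable.lintegral_kernel_prod_right' (κ := σ.kernel n)
        (f := fun q : Hist X.State (Move X.State A) n × Move X.State A =>
          f (q.1, (q.2, (0, Function.uncurry next (Move.target q.2 (curState n q.1)))))) ?_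
      exact hf.comp (measurable_fst.prodMk (measurable_snd.prodMk (measurable_const.prodMk
        ((Measurable.of_discrete (f := Function.uncurry next)).comp (measurable_target n)))))
    have h0 : ∀ h D, ∫⁻ y, f (h, (D, y)) ∂(nullKernel next (Move.target D (curState n h))) =
        f (h, (D, (0, Function.uncurry next (Move.target D (curState n h))))) := by
      intro h D
      simp only [nullKernel, Kernel.deterministic_apply]
      exact lintegral_dirac' _ (hf.comp (measurable_prodMk_left.comp measurable_prodMk_left))
    simp only [h0]
    refine le_trans (lintegral_mono fun h => ?_) (ih g hgm)
    by_cases hh : h ∈ Unrevealing next s n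
    · rw [Set.indicator_of_mem hh]
      refine lintegral_mono fun D => ?_
      set y0 := ((0 : ℝ), Function.uncurry next (Move.target D (curState n h))) with hy0
      calc _ ≤ ∫⁻ y, f (h, (D, y0)) ∂(Q (Move.target D (curState n h))) := by
            refine lintegral_mono fun y => ?_
            by_cases hy : y = y0
            · rw [hy]
              exact Set.indicator_le_self _ _ _
            · rw [Set.indicator_of_notMem]
              · exact bot_le
              · exact fun hn => hy hn.2
        _ = f (h, (D, y0)) := by rw [lintegral_const, measure_univ, mul_one]
    · refine le_trans (le_of_eq ?_) bot_le
      refine lintegral_eq_zero_of_ae_eq_zero (Filter.Eventually.of_forall fun D => ?_)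
      refine lintegral_eq_zero_of_ae_eq_zero (Filter.Eventually.of_forall fun y => ?_)
      exact Set.indicator_of_notMem (fun hn => hh hn.1) _

theorem measurable_lintegral_target (σ : Strategy X.State (Move X.State A)) (n : ℕ)
    (b : X.State × Fin A → ℝ≥0∞) :
    Measurable fun h => ∫⁻ D, b (Move.target D (curState n h)) ∂(σ.kernel n h) :=
  Measurable.lintegral_kernel_prod_right' (κ := σ.kernel n)
    ((Measurable.of_discrete (f := b)).comp (measurable_target n))

theorem measure_not_unrevealing_succ (σ : Strategy X.State (Move X.State A))
    (Q : Kernel (X.State × Fin A) (ℝ × X.State)) [IsMarkovKernel Q]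
    (next : X.State → Fin A → X.State) (s : X.State) (n : ℕ) :
    histLaw σ (queryEnv Q) s (n + 1) (Unrevealing next s (n + 1))ᶜ ≤
      histLaw σ (queryEnv Q) s n (Unrevealing next s n)ᶜ +
        ∫⁻ h, ∫⁻ D, revealProb Q next (Move.target D (curState n h)) ∂(σ.kernel n h)
          ∂(histLaw σ (queryEnv (nullKernel next)) s n) := by
  have hG := measurableSet_unrevealing (A := A) next s
  rw [← lintegral_indicator_one (hG (n + 1)).compl, ← lintegral_indicator_one (hG n).compl,
    lintegral_queryEnv_succ σ Q s n _ (measurable_one.indicator (hG (n + 1)).compl)]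
  refine le_trans ?_ (add_le_add_right (lintegral_unrevealing_le σ Q next s n _
    (measurable_lintegral_target σ n _)) _)
  rw [← lintegral_add_left (measurable_one.indicator (hG n).compl)]
  refine lintegral_mono fun h => ?_
  by_cases hh : h ∈ Unrevealing next s n
  · rw [Set.indicator_of_notMem (by exact not_not.2 hh), Set.indicator_of_mem hh, zero_add]
    refine lintegral_mono fun D => ?_
    have hc : MeasurableSet
        ({((0 : ℝ), Function.uncurry next (Move.target D (curState n h)))}ᶜ : Set (ℝ × X.State)) :=
      (measurableSet_singleton _).compl
    rw [revealProb, ← lintegral_indicator_one hc]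
    refine lintegral_mono fun y => ?_
    by_cases hy : y = (0, Function.uncurry next (Move.target D (curState n h)))
    · rw [Set.indicator_of_notMem]
      · exact bot_le
      · exact not_not.2 ⟨hh, hy⟩
    · rw [Set.indicator_of_mem (s := {_}ᶜ) (by exact hy)]
      exact Set.indicator_le_self' (by simp) _
  · refine le_add_right ?_
    rw [Set.indicator_of_mem (by exact hh)]
    calc _ ≤ ∫⁻ D, ∫⁻ y, 1 ∂(Q (Move.target D (curState n h))) ∂(σ.kernel n h) :=
          lintegral_mono fun D => lintegral_mono fun y => by
            classical
            rw [Set.indicator_apply]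
            split_ifs <;> simp
      _ = 1 := by simp

/-- A union bound, over the rounds and over the models, for the probability of a revealing
history: since the reward-free model does not depend on `i`, the sum over `i` can be taken
inside. -/
theorem sum_measure_not_unrevealing_le {ι : Type*} (W : Finset ι)
    (σ : Strategy X.State (Move X.State A))
    (Q : ι → Kernel (X.State × Fin A) (ℝ × X.State)) [∀ i, IsMarkovKernel (Q i)]
    (next : X.State → Fin A → X.State) (s : X.State) (b : ℝ≥0∞)
    (hb : ∀ p, ∑ i ∈ W, revealProb (Q i) next p ≤ b) (n : ℕ) :
    ∑ i ∈ W, histLaw σ (queryEnv (Q i)) s n (Unrevealing next s n)ᶜ ≤ n * b := by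
  induction n with
  | zero =>
    have h0 : ∀ i, histLaw σ (queryEnv (Q i)) s 0 (Unrevealing next s 0)ᶜ = 0 := fun i => by
      change Measure.dirac (α := X.State) s ({s}ᶜ : Set X.State) = 0
      simp
    simp [h0]
  | succ n ih =>
    refine (Finset.sum_le_sum fun i _ =>
      measure_not_unrevealing_succ σ (Q i) next s n).trans ?_
    rw [Finset.sum_add_distrib, Nat.cast_succ, add_mul, one_mul]
    refine add_le_add ih ?_
    have := isProbabilityMeasure_histLaw σ (queryEnv (nullKernel next)) s n
    rw [← lintegral_finsetSum _ fun i _ => measurable_lintegral_target σ n _]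
    calc _ ≤ ∫⁻ _, b ∂(histLaw σ (queryEnv (nullKernel next)) s n) := by
          refine lintegral_mono fun h => ?_
          rw [← lintegral_finsetSum _ fun i _ => Measurable.of_discrete]
          calc _ ≤ ∫⁻ _, b ∂(σ.kernel n h) := lintegral_mono fun D => hb _
            _ = b := by simp
      _ = b := by simp

/-! ### The reward of an episode -/

theorem measurable_episodeReward :
    (n : ℕ) → Measurable (episodeReward (S := X.State) (A := A) n)
  | 0 => measurable_const
  | n + 1 => by
    have h : Measurable fun h : Hist X.State (Move X.State A) n ×
        (Move X.State A × (ℝ × X.State)) => episodeReward n h.1 +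
          ({D | D.isRight} : Set (Move X.State A)).indicator (fun _ => 1) h.2.1 *
            ENNReal.ofReal h.2.2.1 :=
      ((measurable_episodeReward n).comp measurable_fst).add
        (((Measurable.of_discrete (f := Set.indicator {D : Move X.State A | D.isRight}
            (fun _ => (1 : ℝ≥0∞)))).comp (measurable_fst.comp measurable_snd)).mul
          (ENNReal.measurable_ofReal.comp
            (measurable_fst.comp (measurable_snd.comp measurable_snd))))
    refine (congrArg Measurable (funext fun h => ?_)).mp h
    obtain ⟨h, D | D, y⟩ := h <;> simp [episodeReward, Set.indicator_apply]

/-- The part of the unit reward of an episode that is still to be won. -/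
def stake (s : X.State) : ℝ≥0∞ := ({X.bot}ᶜ : Set X.State).indicator (fun _ => 1) s

/-- The reward collected so far plus the stake; it is nonincreasing along an episode. -/
def rewardPotential (n : ℕ) (h : Hist X.State (Move X.State A) n) : ℝ≥0∞ :=
  episodeReward n h + stake (curState n h)

theorem measurable_rewardPotential (n : ℕ) :
    Measurable (rewardPotential (X := X) (A := A) n) :=
  (measurable_episodeReward n).add
    ((Measurable.of_discrete (f := stake (X := X))).comp (measurable_curState n))

theorem lintegral_rewardPotential_succ_le (σ : Strategy X.State (Move X.State A))
    (Q : Kernel (X.State × Fin A) (ℝ × X.State)) [IsMarkovKernel Q]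
    (hQ : ∀ p, ∀ᵐ y ∂(Q p), ENNReal.ofReal y.1 + stake y.2 ≤ stake p.1)
    (s : X.State) (g : ℝ≥0∞ → ℝ≥0∞) (hg : Monotone g) (n : ℕ) :
    ∫⁻ h, g (rewardPotential (n + 1) h) ∂(histLaw σ (queryEnv Q) s (n + 1)) ≤
      ∫⁻ h, g (rewardPotential n h) ∂(histLaw σ (queryEnv Q) s n) := by
  rw [lintegral_queryEnv_succ σ Q s n (fun h => g (rewardPotential (n + 1) h))
    (hg.measurable.comp (measurable_rewardPotential (n + 1)))]
  refine lintegral_mono fun h => ?_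
  calc _ ≤ ∫⁻ D, ∫⁻ y, g (rewardPotential n h) ∂(Q (Move.target D (curState n h)))
          ∂(σ.kernel n h) := by
        refine lintegral_mono fun D => lintegral_mono_ae ?_
        rcases D with q | a
        · exact Filter.Eventually.of_forall fun y => le_rfl
        · filter_upwards [hQ (curState n h, a)] with y hy
          refine hg ?_
          change episodeReward n h + ENNReal.ofReal y.1 + stake y.2 ≤
            episodeReward n h + stake (curState n h)
          rw [add_assoc]
          gcongr
    _ = g (rewardPotential n h) := by simp

theorem stake_le_one (s : X.State) : stake s ≤ 1 := by
  classical
  rw [stake, Set.indicator_apply]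
  split_ifs <;> simp

theorem rewardPotential_le_one (σ : Strategy X.State (Move X.State A))
    (Q : Kernel (X.State × Fin A) (ℝ × X.State)) [IsMarkovKernel Q]
    (hQ : ∀ p, ∀ᵐ y ∂(Q p), ENNReal.ofReal y.1 + stake y.2 ≤ stake p.1)
    (s : X.State) (n : ℕ) :
    ∀ᵐ h ∂(histLaw σ (queryEnv Q) s n), rewardPotential n h ≤ 1 := by
  have hg : Monotone ((Set.Ioi (1 : ℝ≥0∞)).indicator (fun _ => (1 : ℝ≥0∞))) := by
    intro x y hxy
    by_cases hx : 1 < x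
    · rw [Set.indicator_of_mem (by exact hx), Set.indicator_of_mem (by exact hx.trans_le hxy)]
    · rw [Set.indicator_of_notMem (by exact hx)]
      exact bot_le
  have hz : ∫⁻ h, (Set.Ioi (1 : ℝ≥0∞)).indicator (fun _ => (1 : ℝ≥0∞)) (rewardPotential n h)
      ∂(histLaw σ (queryEnv Q) s n) = 0 := by
    induction n with
    | zero =>
      refine (lintegral_histLaw_zero σ (queryEnv Q) s _ Measurable.of_discrete).trans ?_
      refine Set.indicator_of_notMem ?_ _
      change ¬ (1 < (0 : ℝ≥0∞) + stake s)
      rw [zero_add, not_lt]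
      exact stake_le_one s
    | succ n ih =>
      exact le_antisymm ((lintegral_rewardPotential_succ_le σ Q hQ s _ hg n).trans_eq ih) bot_le
  rw [lintegral_eq_zero_iff (f := fun h => (Set.Ioi (1 : ℝ≥0∞)).indicator (fun _ => (1 : ℝ≥0∞))
    (rewardPotential n h)) (hg.measurable.comp (measurable_rewardPotential n))] at hz
  filter_upwards [hz] with h hh
  by_contra hn
  have h1 := Set.indicator_of_mem (s := Set.Ioi (1 : ℝ≥0∞)) (not_le.1 hn) (fun _ => (1 : ℝ≥0∞))
  rw [h1] at hh
  simp at hh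

theorem lintegral_episodeReward_mono (σ : Strategy X.State (Move X.State A))
    (Q : Kernel (X.State × Fin A) (ℝ × X.State)) [IsMarkovKernel Q] (s : X.State) :
    Monotone fun n => ∫⁻ h, episodeReward n h ∂(histLaw σ (queryEnv Q) s n) := by
  refine monotone_nat_of_le_succ fun n => ?_
  rw [lintegral_queryEnv_succ σ Q s n _ (measurable_episodeReward (n + 1))]
  refine lintegral_mono fun h => ?_
  calc episodeReward n h = ∫⁻ D, ∫⁻ y, episodeReward n h ∂(Q (Move.target D (curState n h)))
          ∂(σ.kernel n h) := by simp
    _ ≤ _ := by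
        refine lintegral_mono fun D => lintegral_mono fun y => ?_
        rcases D with q | a
        · exact le_rfl
        · exact le_self_add

theorem measurable_callIndex : (n : ℕ) → Measurable (callIndex (S := X.State) (A := A) n)
  | 0 => measurable_const
  | n + 1 => by
    have h : Measurable fun h : Hist X.State (Move X.State A) n ×
        (Move X.State A × (ℝ × X.State)) => callIndex n h.1 +
          ({D | D.isRight} : Set (Move X.State A)).indicator (fun _ => 1) h.2.1 :=
      ((measurable_callIndex n).comp measurable_fst).add
        ((Measurable.of_discrete (f := Set.indicator {D : Move X.State A | D.isRight}
            (fun _ => (1 : ℕ)))).comp (measurable_fst.comp measurable_snd))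
    refine (congrArg Measurable (funext fun h => ?_)).mp h
    obtain ⟨h, D | D, y⟩ := h <;> simp [callIndex, Set.indicator_apply]

theorem measurable_queriesInCall (t : ℕ) :
    (n : ℕ) → Measurable (queriesInCall (S := X.State) (A := A) t n)
  | 0 => measurable_const
  | n + 1 => by
    have h : Measurable fun h : Hist X.State (Move X.State A) n ×
        (Move X.State A × (ℝ × X.State)) => queriesInCall t n h.1 +
          {D : Move X.State A | D.isLeft}.indicator (fun _ => 1) h.2.1 *
            ({t} : Set ℕ).indicator (fun _ => 1) (callIndex n h.1) :=
      ((measurable_queriesInCall t n).comp measurable_fst).add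
        (((Measurable.of_discrete (f := Set.indicator {D : Move X.State A | D.isLeft}
            (fun _ => (1 : ℝ≥0∞)))).comp (measurable_fst.comp measurable_snd)).mul
          ((Measurable.of_discrete (f := Set.indicator ({t} : Set ℕ) (fun _ => (1 : ℝ≥0∞)))).comp
            ((measurable_callIndex n).comp measurable_fst)))
    refine (congrArg Measurable (funext fun h => ?_)).mp h
    obtain ⟨h, D | D, y⟩ := h <;> simp [queriesInCall, Set.indicator_apply]

/-- As long as fewer than `T` calls are completed, all rounds are accounted for by completed
calls and by queries in the first `T` calls. -/
theorem sum_queriesInCall_add (T : ℕ) : ∀ (n : ℕ) (h : Hist X.State (Move X.State A) n),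
    callIndex n h < T → ∑ t ∈ Finset.range T, queriesInCall t n h + callIndex n h = n
  | 0, _, _ => by simp [queriesInCall, callIndex]
  | n + 1, (h, (.inl q, y)), hT => by
    have ih := sum_queriesInCall_add T n h hT
    change ∑ t ∈ Finset.range T, (queriesInCall t n h + if callIndex n h = t then 1 else 0) +
      (callIndex n h : ℝ≥0∞) = _
    have hT' : callIndex n h < T := hT
    rw [Finset.sum_add_distrib, Finset.sum_ite_eq, if_pos (Finset.mem_range.2 hT'),
      add_right_comm, ih, Nat.cast_succ]
  | n + 1, (h, (.inr a, y)), hT => by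
    have hT' : callIndex n h + 1 < T := hT
    have ih := sum_queriesInCall_add T n h (by omega)
    change ∑ t ∈ Finset.range T, queriesInCall t n h + ((callIndex n h + 1 : ℕ) : ℝ≥0∞) = _
    rw [Nat.cast_succ, ← add_assoc, ih, Nat.cast_succ]

/-- Markov's inequality for the number of rounds that the first `T` calls take. -/
theorem mul_measure_callIndex_lt_le (σ : Strategy X.State (Move X.State A))
    (Q : Kernel (X.State × Fin A) (ℝ × X.State)) [IsMarkovKernel Q] (s : X.State)
    (T n : ℕ) (C : ℝ≥0∞)
    (hC : ∀ t < T, ∫⁻ h, queriesInCall t (n + T) h ∂(histLaw σ (queryEnv Q) s (n + T)) ≤ C) :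
    n * histLaw σ (queryEnv Q) s (n + T) {h | callIndex (n + T) h < T} ≤ T * C := by
  have hm : Measurable fun h : Hist X.State (Move X.State A) (n + T) =>
      ∑ t ∈ Finset.range T, queriesInCall t (n + T) h :=
    Finset.measurable_sum _ fun t _ => measurable_queriesInCall t (n + T)
  calc n * histLaw σ (queryEnv Q) s (n + T) {h | callIndex (n + T) h < T}
      ≤ n * histLaw σ (queryEnv Q) s (n + T)
          {h | (n : ℝ≥0∞) ≤ ∑ t ∈ Finset.range T, queriesInCall t (n + T) h} := by
        gcongr with h
        intro hh
        have h1 := sum_queriesInCall_add T (n + T) h hh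
        have h2 : (callIndex (n + T) h : ℝ≥0∞) ≤ T := by exact_mod_cast hh.le
        have h3 : (n : ℝ≥0∞) + T ≤ ∑ t ∈ Finset.range T, queriesInCall t (n + T) h + T := by
          rw [← Nat.cast_add, ← h1]
          gcongr
        exact (ENNReal.add_le_add_iff_right (ENNReal.natCast_ne_top T)).1 h3
    _ ≤ ∫⁻ h, ∑ t ∈ Finset.range T, queriesInCall t (n + T) h
          ∂(histLaw σ (queryEnv Q) s (n + T)) := mul_meas_ge_le_lintegral hm _
    _ = ∑ t ∈ Finset.range T, ∫⁻ h, queriesInCall t (n + T) h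
          ∂(histLaw σ (queryEnv Q) s (n + T)) :=
        lintegral_finsetSum _ fun t _ => measurable_queriesInCall t (n + T)
    _ ≤ ∑ t ∈ Finset.range T, C :=
        Finset.sum_le_sum fun t ht => hC t (Finset.mem_range.1 ht)
    _ = T * C := by simp

/-- On unrevealing histories nothing is won, and after `T` calls the episode is over. -/
theorem episodeReward_eq_zero_of_unrevealing (next : X.State → Fin A → X.State) (T : ℕ)
    (hbot : ∀ a, next X.bot a = X.bot)
    (hnext : ∀ s a, s ≠ X.bot → next s a = X.bot ∨
      (X.stage (next s a) = X.stage s + 1 ∧ X.stage (next s a) < T)) (hT : 0 < T)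
    (s : X.State) (hs : X.stage s = 0) : ∀ (n : ℕ) (h : Hist X.State (Move X.State A) n),
    h ∈ Unrevealing next s n → episodeReward n h = 0 ∧ (curState n h = X.bot ∨
        (X.stage (curState n h) = callIndex n h ∧ X.stage (curState n h) < T))
  | 0, h, hh => by
    have h1 : h = s := hh
    subst h1
    exact ⟨rfl, Or.inr ⟨hs, by change X.stage h < T; omega⟩⟩
  | n + 1, (h, (.inl q, y)), hh =>
    episodeReward_eq_zero_of_unrevealing next T hbot hnext hT s hs n h hh.1
  | n + 1, (h, (.inr a, y)), hh => by
    obtain ⟨h1, h2⟩ := episodeReward_eq_zero_of_unrevealing next T hbot hnext hT s hs n h hh.1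
    have hy : y = (0, next (curState n h) a) := hh.2
    subst hy
    refine ⟨?_, ?_⟩
    · change episodeReward n h + ENNReal.ofReal 0 = 0
      simp [h1]
    · change next (curState n h) a = X.bot ∨ (X.stage (next (curState n h) a) =
        callIndex n h + 1 ∧ X.stage (next (curState n h) a) < T)
      by_cases hb : curState n h = X.bot
      · rw [hb, hbot]
        exact Or.inl rfl
      · have h3 := h2.resolve_left hb
        rw [← h3.1]
        exact hnext _ a hb

/-- The expected reward of an episode is at most the probability that the first `n` rounds
are revealing or contain fewer than `T` calls. -/
theorem iSup_episodeReward_le (σ : Strategy X.State (Move X.State A))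
    (Q : Kernel (X.State × Fin A) (ℝ × X.State)) [IsMarkovKernel Q]
    (hQ : ∀ p, ∀ᵐ y ∂(Q p), ENNReal.ofReal y.1 + stake y.2 ≤ stake p.1)
    (next : X.State → Fin A → X.State) (T : ℕ)
    (hbot : ∀ a, next X.bot a = X.bot)
    (hnext : ∀ s a, s ≠ X.bot → next s a = X.bot ∨
      (X.stage (next s a) = X.stage s + 1 ∧ X.stage (next s a) < T)) (hT : 0 < T)
    (s : X.State) (hs : X.stage s = 0) (n : ℕ) :
    ⨆ k, ∫⁻ h, episodeReward k h ∂(histLaw σ (queryEnv Q) s k) ≤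
      histLaw σ (queryEnv Q) s n (Unrevealing next s n)ᶜ +
        histLaw σ (queryEnv Q) s n {h | callIndex n h < T} := by
  refine iSup_le fun k => ?_
  have hanti : Antitone fun n =>
      ∫⁻ h, rewardPotential n h ∂(histLaw σ (queryEnv Q) s n) :=
    antitone_nat_of_succ_le fun n =>
      lintegral_rewardPotential_succ_le σ Q hQ s id monotone_id n
  have hms : MeasurableSet ((Unrevealing next s n)ᶜ ∪
      {h : Hist X.State (Move X.State A) n | callIndex n h < T}) :=
    (measurableSet_unrevealing next s n).compl.union
      (measurable_callIndex n (MeasurableSet.of_discrete (s := Set.Iio T)))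
  calc ∫⁻ h, episodeReward k h ∂(histLaw σ (queryEnv Q) s k)
      ≤ ∫⁻ h, episodeReward (max k n) h ∂(histLaw σ (queryEnv Q) s (max k n)) :=
        lintegral_episodeReward_mono σ Q s (le_max_left k n)
    _ ≤ ∫⁻ h, rewardPotential (max k n) h ∂(histLaw σ (queryEnv Q) s (max k n)) :=
        lintegral_mono fun h => le_self_add
    _ ≤ ∫⁻ h, rewardPotential n h ∂(histLaw σ (queryEnv Q) s n) := hanti (le_max_right k n)
    _ ≤ ∫⁻ h, ((Unrevealing next s n)ᶜ ∪
          {h : Hist X.State (Move X.State A) n | callIndex n h < T}).indicator 1 h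
          ∂(histLaw σ (queryEnv Q) s n) := by
        refine lintegral_mono_ae ?_
        filter_upwards [rewardPotential_le_one σ Q hQ s n] with h hh
        by_cases hbad : h ∈ ((Unrevealing next s n)ᶜ ∪
          {h : Hist X.State (Move X.State A) n | callIndex n h < T})
        · rw [Set.indicator_of_mem hbad]
          exact hh
        · rw [Set.mem_union, not_or, Set.notMem_compl_iff] at hbad
          have hc : T ≤ callIndex n h := not_lt.1 hbad.2
          obtain ⟨h1, h2⟩ :=
            episodeReward_eq_zero_of_unrevealing next T hbot hnext hT s hs n h hbad.1
          have h3 : curState n h = X.bot := by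
            rcases h2 with h2 | h2
            · exact h2
            · omega
          simp [rewardPotential, h1, h3, stake]
    _ = histLaw σ (queryEnv Q) s n ((Unrevealing next s n)ᶜ ∪
          {h : Hist X.State (Move X.State A) n | callIndex n h < T}) :=
        lintegral_indicator_one hms
    _ ≤ _ := measure_union_le _ _

theorem DetModel.ae_stake (m : DetModel X A) (p : X.State × Fin A) :
    ∀ᵐ y ∂(m.kernel p), ENNReal.ofReal y.1 + stake y.2 ≤ stake p.1 := by
  refine m.ae_law (fun h => ?_) ?_
  · have h1 : p.1 ∈ ({X.bot}ᶜ : Set X.State) := fun hb => by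
      rw [Set.mem_singleton_iff.1 hb] at h
      exact h (m.rew_bot _)
    simp only [m.next_of_rew _ _ h, stake]
    rw [Set.indicator_of_mem h1]
    simp
  · by_cases hb : p.1 = X.bot
    · simp [hb, m.next_bot, stake]
    · have h1 : p.1 ∈ ({X.bot}ᶜ : Set X.State) := hb
      simp only [ENNReal.ofReal_zero, zero_add]
      rw [stake, stake, Set.indicator_of_mem h1]
      exact stake_le_one _

theorem DetModel.revealProb_le_one (m : DetModel X A) (next : X.State → Fin A → X.State)
    (p : X.State × Fin A) : revealProb m.kernel next p ≤ 1 :=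
  prob_le_one

theorem DetModel.revealProb_le_rew (m : DetModel X A) (next : X.State → Fin A → X.State)
    (p : X.State × Fin A) (h : m.next p.1 p.2 = next p.1 p.2) :
    revealProb m.kernel next p ≤ ENNReal.ofReal (m.rew p.1 p.2) := by
  classical
  have hms : MeasurableSet ({((0 : ℝ), Function.uncurry next p)}ᶜ : Set (ℝ × X.State)) :=
    (measurableSet_singleton _).compl
  rw [revealProb, ← lintegral_indicator_one hms]
  refine (m.lintegral_law p _).trans_le ?_
  have h0 : ({((0 : ℝ), Function.uncurry next p)}ᶜ : Set (ℝ × X.State)).indicator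
      (1 : ℝ × X.State → ℝ≥0∞) (0, m.next p.1 p.2) = 0 :=
    Set.indicator_of_notMem (not_not.2 (by rw [h]; rfl)) _
  rw [h0, mul_zero, add_zero]
  refine mul_le_of_le_one_right bot_le ?_
  rw [Set.indicator_apply]
  split_ifs <;> simp

/-- The lower bound method. For a family of models on the same state space and with the same
features, that look like a reward-free model except with small probability for most members,
every planner that is sound for all members needs `C` expected queries in some call. -/
theorem le_queryComplexity {F : Type → Type} (𝓜 : Set (FMDP H A F)) (δ : ℝ)
    (hδ : δ ≤ 1 / 100) (φ : F X.State) {ι : Type*} (W : Finset ι) (m : ι → DetModel X A)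
    (hmem : ∀ i ∈ W, (⟨(m i).toMDP, φ⟩ : FMDP H A F) ∈ 𝓜) (s : X.State) (hs : X.stage s = 0)
    (hv : ∀ i ∈ W, 1 / 2 ≤ (m i).toMDP.vStar s)
    (next : X.State → Fin A → X.State) (T : ℕ)
    (hbot : ∀ a, next X.bot a = X.bot)
    (hnext : ∀ s a, s ≠ X.bot → next s a = X.bot ∨
      (X.stage (next s a) = X.stage s + 1 ∧ X.stage (next s a) < T)) (hT : 0 < T) (hTH : T ≤ H)
    (b : ℝ≥0∞) (hb : ∀ p, ∑ i ∈ W, revealProb (m i).kernel next p ≤ b)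
    (n : ℕ) (hn : n ≠ 0) (C : ℝ≥0∞) (hC : 8 * (T * C) ≤ n)
    (hW : ((n + T : ℕ) : ℝ≥0∞) * b < W.card / 4) : C ≤ queryComplexity 𝓜 δ := by
  refine le_iInf₂ fun P hP => ?_
  by_contra hlt
  rw [not_le] at hlt
  refine absurd hW (not_lt.2 ?_)
  refine le_trans ?_ (sum_measure_not_unrevealing_le W (P X φ) (fun i => (m i).kernel)
    next s b hb (n + T))
  have key : ∀ i ∈ W, 1 / 4 ≤ histLaw (P X φ) (queryEnv (m i).kernel) s (n + T)
      (Unrevealing next s (n + T))ᶜ := by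
    intro i hi
    have hcost : ∀ t < T, ∫⁻ h, queriesInCall t (n + T) h
        ∂(histLaw (P X φ) (queryEnv (m i).kernel) s (n + T)) ≤ C := by
      intro t ht
      refine le_trans ?_ hlt.le
      refine le_trans ?_ (le_iSup₂ (f := fun N (_ : N ∈ 𝓜) => P.queryCost N) _ (hmem i hi))
      refine le_trans ?_ (le_iSup₂ (f := fun (s : X.State) (_ : X.stage s = 0) =>
        ⨆ (t : Fin H) (n : ℕ), ∫⁻ h, queriesInCall (t : ℕ) n h
          ∂(P.law (⟨(m i).toMDP, φ⟩ : FMDP H A F) s n)) s hs)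
      exact le_iSup₂ (f := fun (t : Fin H) (n : ℕ) => ∫⁻ h, queriesInCall (t : ℕ) n h
          ∂(P.law (⟨(m i).toMDP, φ⟩ : FMDP H A F) s n)) ⟨t, ht.trans_le hTH⟩ (n + T)
    have h1 := mul_measure_callIndex_lt_le (P X φ) (m i).kernel s T n C hcost
    have h2 : (1 : ℝ≥0∞) / 2 ≤ (⨆ k, ∫⁻ h, episodeReward k h
        ∂(histLaw (P X φ) (queryEnv (m i).kernel) s k)) + ENNReal.ofReal δ :=
      (hv i hi).trans (hP _ (hmem i hi) s hs)
    have h3 := iSup_episodeReward_le (P X φ) (m i).kernel (m i).ae_stake next T hbot hnext hT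
      s hs (n + T)
    have := isProbabilityMeasure_histLaw (P X φ) (queryEnv (m i).kernel) s (n + T)
    generalize hx : histLaw (P X φ) (queryEnv (m i).kernel) s (n + T)
      (Unrevealing next s (n + T))ᶜ = x at h3 ⊢
    generalize hy : histLaw (P X φ) (queryEnv (m i).kernel) s (n + T)
      {h | callIndex (n + T) h < T} = y at h1 h3
    have h4 : ENNReal.ofReal δ ≤ ENNReal.ofReal (1 / 100) := ENNReal.ofReal_le_ofReal hδ
    have h5 : (1 : ℝ≥0∞) / 2 ≤ x + y + ENNReal.ofReal (1 / 100) :=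
      h2.trans (add_le_add h3 h4)
    have h6 : 8 * (n * y) ≤ (n : ℝ≥0∞) := (mul_le_mul_right h1 8).trans hC
    have hxt : x ≠ ⊤ := hx ▸ measure_ne_top _ _
    have hyt : y ≠ ⊤ := hy ▸ measure_ne_top _ _
    lift x to NNReal using hxt
    lift y to NNReal using hyt
    have h7 : (8 : ℝ) * (n * y) ≤ n := by
      have : ((8 * (n * y) : NNReal) : ℝ≥0∞) ≤ ((n : NNReal) : ℝ≥0∞) := by
        push_cast; exact h6
      exact_mod_cast ENNReal.coe_le_coe.1 this
    have h8 : (1 : ℝ) / 2 ≤ x + y + 1 / 100 := by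
      have h := ENNReal.toReal_mono (by finiteness) h5
      rw [ENNReal.toReal_add (by finiteness) (by finiteness),
        ENNReal.toReal_add (by finiteness) (by finiteness),
        ENNReal.toReal_ofReal (by norm_num)] at h
      simpa using h
    have hn' : (0 : ℝ) < n := by exact_mod_cast Nat.pos_of_ne_zero hn
    have h9 : (y : ℝ) ≤ 1 / 8 := by
      by_contra hlt
      nlinarith [not_le.1 hlt]
    have h10 : ((1 / 4 : NNReal) : ℝ) ≤ x := by
      push_cast
      linarith
    have h11 : ((1 / 4 : NNReal) : ℝ≥0∞) ≤ x := ENNReal.coe_le_coe.2 (NNReal.coe_le_coe.1 h10)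
    rw [ENNReal.coe_div (by norm_num)] at h11
    simpa using h11
  calc (W.card : ℝ≥0∞) / 4 = ∑ i ∈ W, 1 / 4 := by
        rw [Finset.sum_const, nsmul_eq_mul, mul_one_div]
    _ ≤ _ := Finset.sum_le_sum key

end Planning

/-! ### The guessing game -/

/-- The factor lost by moving a relative Hamming distance `x`. It is decreasing and log-convex
on `[0, 1]`; a quadratic polynomial with these properties is what makes the construction work. -/
def decay (x : ℝ) : ℝ := 1 - x + x ^ 2 / 2

theorem decay_pos (x : ℝ) : 0 < decay x := by
  unfold decay; nlinarith [sq_nonneg (x - 1)]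

theorem half_le_decay (x : ℝ) : 1 / 2 ≤ decay x := by
  unfold decay; nlinarith [sq_nonneg (x - 1)]

theorem decay_zero : decay 0 = 1 := by simp [decay]

theorem decay_anti {x y : ℝ} (hxy : x ≤ y) (hy : y ≤ 1) : decay y ≤ decay x := by
  unfold decay; nlinarith [mul_nonneg (sub_nonneg.2 hxy) (by linarith : 0 ≤ 2 - x - y)]

theorem decay_le_one {x : ℝ} (h0 : 0 ≤ x) (h1 : x ≤ 1) : decay x ≤ 1 :=
  decay_zero ▸ decay_anti h0 h1

/-- Log-convexity of `decay`, in the form of an exchange inequality. -/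
theorem decay_mul_le {a m r : ℝ} (hm : 0 ≤ m) (hma : m ≤ a) (hr : 0 ≤ r) (h1 : a + r ≤ 1) :
    decay a * decay (m + r) ≤ decay (a + r) * decay m := by
  have h2 : 0 ≤ a + m - a * m := by nlinarith
  have h3 : 0 ≤ r * (1 - (a + m) / 2) := mul_nonneg hr (by linarith)
  have h4 : 0 ≤ r * (a - m) * ((a + m - a * m) / 2 + r * (1 - (a + m) / 2) / 2) :=
    mul_nonneg (mul_nonneg hr (sub_nonneg.2 hma)) (by linarith)
  unfold decay
  linarith [h4]

/-- A configuration of the game on the cube, whose vertices are encoded as subsets of `Fin p`.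
In each phase, the player flips a set of at least `p / 4` bits, one at a time, and thereby moves
from the vertex `base` to a new one. -/
structure Conf (p : ℕ) where
  /-- the product of the decay factors of the completed phases -/
  factor : ℝ
  /-- the vertices reached at the ends of the completed phases -/
  visited : List (Finset (Fin p))
  /-- the vertex at which the current phase started -/
  base : Finset (Fin p)
  /-- the bits flipped in the current phase -/
  flipped : Finset (Fin p)
  /-- whether no phase was ended with too few flips -/
  legal : Bool

namespace Conf

variable {p : ℕ}

/-- The game lasts for `p` phases. -/
def Running (x : Conf p) : Prop := x.legal = true ∧ x.visited.length < p

open Classical in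
/-- Effect of an action: a bit not yet flipped in this phase is flipped, and any other action
ends the phase. -/
def step (x : Conf p) (a : ℕ) : Conf p :=
  if x.Running then
    if h : ∃ ha : a < p, (⟨a, ha⟩ : Fin p) ∉ x.flipped then
      { x with flipped := insert ⟨a, h.1⟩ x.flipped }
    else if p ≤ 4 * x.flipped.card then
      { x with
        factor := x.factor * decay (x.flipped.card / p)
        visited := (x.base ∆ x.flipped) :: x.visited
        base := x.base ∆ x.flipped
        flipped := ∅ }
    else { x with legal := false }
  else x

/-- The value of a configuration when the secret vertex is `u`. In the best continuation, the
current phase ends in `u` with the wrongly flipped bits negated, and the next one in `u`. -/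
def value (x : Conf p) (u : Finset (Fin p)) : ℝ :=
  if x.legal then
    x.factor * (decay ((x.flipped ∪ (x.base ∆ u)).card / p) *
      decay ((x.flipped \ (x.base ∆ u)).card / p))
  else 0

/-- The game goes on and no visited vertex is close to the secret vertex `u`. -/
def Alive (x : Conf p) (u : Finset (Fin p)) : Prop :=
  x.Running ∧ ∀ v ∈ x.visited, p ≤ 4 * (v ∆ u).card

theorem card_div_le_one (s : Finset (Fin p)) : (s.card : ℝ) / p ≤ 1 := by
  have : s.card ≤ p := by simpa using s.card_le_univ
  exact div_le_one_of_le₀ (by exact_mod_cast this) (Nat.cast_nonneg p)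

theorem card_div_nonneg (s : Finset (Fin p)) : (0 : ℝ) ≤ (s.card : ℝ) / p := by positivity

theorem step_of_not_running {x : Conf p} (h : ¬ x.Running) (a : ℕ) : x.step a = x := by
  simp [step, h]

theorem step_flip {x : Conf p} (h : x.Running) {a : ℕ} (ha : a < p)
    (hf : (⟨a, ha⟩ : Fin p) ∉ x.flipped) :
    x.step a = { x with flipped := insert ⟨a, ha⟩ x.flipped } := by
  unfold step
  rw [if_pos h, dif_pos ⟨ha, hf⟩]

theorem step_stop {x : Conf p} (h : x.Running) {a : ℕ}
    (hf : ¬ ∃ ha : a < p, (⟨a, ha⟩ : Fin p) ∉ x.flipped) (hc : p ≤ 4 * x.flipped.card) :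
    x.step a = { x with
        factor := x.factor * decay (x.flipped.card / p)
        visited := (x.base ∆ x.flipped) :: x.visited
        base := x.base ∆ x.flipped
        flipped := ∅ } := by
  unfold step
  rw [if_pos h, dif_neg hf, if_pos hc]

theorem step_illegal {x : Conf p} (h : x.Running) {a : ℕ}
    (hf : ¬ ∃ ha : a < p, (⟨a, ha⟩ : Fin p) ∉ x.flipped) (hc : ¬ p ≤ 4 * x.flipped.card) :
    x.step a = { x with legal := false } := by
  unfold step
  rw [if_pos h, dif_neg hf, if_neg hc]

theorem value_nonneg {x : Conf p} (hx : 0 ≤ x.factor) (u : Finset (Fin p)) :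
    0 ≤ x.value u := by
  unfold value
  split_ifs
  · exact mul_nonneg hx (mul_nonneg (decay_pos _).le (decay_pos _).le)
  · exact le_rfl

theorem value_le_factor {x : Conf p} (hx : 0 ≤ x.factor) (u : Finset (Fin p)) :
    x.value u ≤ x.factor := by
  unfold value
  split_ifs
  · exact mul_le_of_le_one_right hx (mul_le_one₀
      (decay_le_one (card_div_nonneg _) (card_div_le_one _)) (decay_pos _).le
      (decay_le_one (card_div_nonneg _) (card_div_le_one _)))
  · exact hx

/-- At the end of a phase, the value is that of the move just made, times that of a next phase
leading straight to the secret vertex. -/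
theorem value_step_stop {x : Conf p} (h : x.Running) {a : ℕ}
    (hf : ¬ ∃ ha : a < p, (⟨a, ha⟩ : Fin p) ∉ x.flipped) (hc : p ≤ 4 * x.flipped.card)
    (u : Finset (Fin p)) :
    (x.step a).value u = x.factor * (decay (x.flipped.card / p) *
      decay (((x.flipped \ (x.base ∆ u)).card : ℝ) / p +
        (((x.base ∆ u) \ x.flipped).card : ℝ) / p)) := by
  rw [step_stop h hf hc]
  have h1 : (x.base ∆ x.flipped) ∆ u = x.flipped ∆ (x.base ∆ u) := by
    rw [symmDiff_comm x.base, symmDiff_assoc]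
  have h2 : (((x.base ∆ x.flipped) ∆ u).card : ℝ) =
      (x.flipped \ (x.base ∆ u)).card + ((x.base ∆ u) \ x.flipped).card := by
    rw [h1, symmDiff_def, Finset.sup_eq_union, Finset.card_union_of_disjoint disjoint_sdiff_sdiff]
    push_cast; rfl
  simp only [value, h.1, if_true, Finset.empty_union, Finset.empty_sdiff, Finset.card_empty,
    Nat.cast_zero, zero_div, decay_zero, mul_one, h2, add_div]
  ring

theorem card_union_eq (F E : Finset (Fin p)) :
    ((F ∪ E).card : ℝ) / p = (F.card : ℝ) / p + ((E \ F).card : ℝ) / p := by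
  rw [← Finset.union_sdiff_self_eq_union, Finset.card_union_of_disjoint Finset.disjoint_sdiff]
  push_cast; ring

/-- No action increases the value. -/
theorem value_step_le {x : Conf p} (h : x.Running) (hx : 0 ≤ x.factor) (a : ℕ)
    (u : Finset (Fin p)) : (x.step a).value u ≤ x.value u := by
  by_cases hf : ∃ ha : a < p, (⟨a, ha⟩ : Fin p) ∉ x.flipped
  · obtain ⟨ha, hf⟩ := hf
    rw [step_flip h ha hf]
    simp only [value, h.1, if_true]
    gcongr
    · exact (decay_pos _).le
    · exact (decay_pos _).le
    · refine decay_anti ?_ (card_div_le_one _)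
      gcongr
      exact Finset.subset_insert _ _
    · refine decay_anti ?_ (card_div_le_one _)
      gcongr
      exact Finset.subset_insert _ _
  · by_cases hc : p ≤ 4 * x.flipped.card
    · rw [value_step_stop h hf hc]
      simp only [value, h.1, if_true]
      rw [card_union_eq]
      refine mul_le_mul_of_nonneg_left (decay_mul_le (card_div_nonneg _) ?_ (card_div_nonneg _)
        ?_) hx
      · gcongr
        exact Finset.sdiff_subset
      · rw [← card_union_eq]
        exact card_div_le_one _
    · rw [step_illegal h hf hc]
      have : ({ x with legal := false } : Conf p).value u = 0 := by simp [value]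
      rw [this]
      exact value_nonneg hx u

/-- Far from the secret vertex, some action preserves the value: flip a bit in which the
current vertex differs from the secret one, and end the phase when there is none left. -/
theorem exists_value_step_eq {x : Conf p} (h : x.Running) (u : Finset (Fin p))
    (hu : p ≤ 4 * (x.base ∆ u).card) : ∃ a < p, (x.step a).value u = x.value u := by
  by_cases hE : (x.base ∆ u) ⊆ x.flipped
  · have hc : p ≤ 4 * x.flipped.card := hu.trans (by have := Finset.card_le_card hE; omega)
    have hp : 0 < p := (Nat.zero_le _).trans_lt h.2
    obtain ⟨a, ha⟩ : x.flipped.Nonempty := Finset.card_pos.1 (by omega)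
    refine ⟨a, a.2, ?_⟩
    rw [value_step_stop h (fun ⟨_, hn⟩ => hn ha) hc]
    simp only [value, h.1, if_true]
    rw [card_union_eq, Finset.sdiff_eq_empty_iff_subset.2 hE]
    simp
  · obtain ⟨a, haE, haF⟩ := Finset.not_subset.1 hE
    refine ⟨a, a.2, ?_⟩
    rw [step_flip h a.2 haF]
    simp only [value, h.1, if_true, Fin.eta]
    rw [Finset.insert_union, Finset.insert_eq_of_mem (Finset.mem_union_right _ haE),
      Finset.insert_sdiff_of_mem _ haE]

/-- The initial configuration, at the vertex `∅`. -/
def init (p : ℕ) : Conf p := ⟨1, [], ∅, ∅, true⟩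

/-- The configuration after a sequence of actions. -/
def ofList {A : ℕ} (p : ℕ) (l : List (Fin A)) : Conf p :=
  l.foldl (fun x a => x.step a) (init p)

variable {A : ℕ}

theorem ofList_concat (l : List (Fin A)) (a : Fin A) :
    ofList p (l ++ [a]) = (ofList p l).step a := by
  simp [ofList]

theorem ofList_induction {P : Conf p → ℕ → Prop} (h0 : P (init p) 0)
    (hs : ∀ x n a, P x n → P (x.step a) (n + 1)) (l : List (Fin A)) :
    P (ofList p l) l.length := by
  induction l using List.reverseRecOn with
  | nil => exact h0
  | append_singleton l a ih =>
    rw [ofList_concat, List.length_append]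
    exact hs _ _ _ ih

/-- Case distinction for a step that is not absorbed. -/
theorem step_cases {P : Conf p → Prop} (x : Conf p) (a : ℕ) (h0 : ¬ x.Running → P x)
    (h1 : x.Running → ∀ ha : a < p, (⟨a, ha⟩ : Fin p) ∉ x.flipped →
      P { x with flipped := insert ⟨a, ha⟩ x.flipped })
    (h2 : x.Running → p ≤ 4 * x.flipped.card → P { x with
        factor := x.factor * decay (x.flipped.card / p)
        visited := (x.base ∆ x.flipped) :: x.visited
        base := x.base ∆ x.flipped
        flipped := ∅ })
    (h3 : x.Running → P { x with legal := false }) : P (x.step a) := by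
  by_cases hr : x.Running
  · by_cases hf : ∃ ha : a < p, (⟨a, ha⟩ : Fin p) ∉ x.flipped
    · obtain ⟨ha, hf⟩ := hf
      rw [step_flip hr ha hf]
      exact h1 hr ha hf
    · by_cases hc : p ≤ 4 * x.flipped.card
      · rw [step_stop hr hf hc]
        exact h2 hr hc
      · rw [step_illegal hr hf hc]
        exact h3 hr
  · rw [step_of_not_running hr]
    exact h0 hr

theorem visited_step_subset (x : Conf p) (a : ℕ) : x.visited ⊆ (x.step a).visited :=
  step_cases (P := fun y => x.visited ⊆ y.visited) x a (fun _ => List.Subset.refl _)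
    (fun _ _ _ => List.Subset.refl _) (fun _ _ => List.subset_cons_self _ _)
    (fun _ => List.Subset.refl _)

theorem factor_mem (l : List (Fin A)) :
    0 ≤ (ofList p l).factor ∧
      (ofList p l).factor ≤ (25 / 32) ^ (ofList p l).visited.length := by
  refine ofList_induction (P := fun x _ => 0 ≤ x.factor ∧
    x.factor ≤ (25 / 32) ^ x.visited.length) ?_ ?_ l
  · simp [init]
  · intro x n a hx
    refine step_cases (P := fun y => 0 ≤ y.factor ∧ y.factor ≤ (25 / 32) ^ y.visited.length)
      x a (fun _ => hx) (fun _ _ _ => hx) (fun hr hc => ?_) (fun _ => hx)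
    refine ⟨mul_nonneg hx.1 (decay_pos _).le, ?_⟩
    simp only [List.length_cons, pow_succ]
    have hp : (0 : ℝ) < p := by exact_mod_cast (Nat.zero_le _).trans_lt hr.2
    have h4 : (1 : ℝ) / 4 ≤ x.flipped.card / p := by
      rw [div_le_div_iff₀ (by norm_num) hp]
      exact_mod_cast (by omega : 1 * p ≤ x.flipped.card * 4)
    have h5 : decay (x.flipped.card / p) ≤ 25 / 32 := by
      refine (decay_anti h4 (card_div_le_one _)).trans ?_
      norm_num [decay]
    exact mul_le_mul hx.2 h5 (decay_pos _).le (by positivity)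

theorem factor_le_one (l : List (Fin A)) : (ofList p l).factor ≤ 1 :=
  (factor_mem l).2.trans (pow_le_one₀ (by norm_num) (by norm_num))

theorem value_mem (l : List (Fin A)) (u : Finset (Fin p)) :
    (ofList p l).value u ∈ Set.Icc (0 : ℝ) 1 :=
  ⟨value_nonneg (factor_mem l).1 u, (value_le_factor (factor_mem l).1 u).trans (factor_le_one l)⟩

theorem length_visited_le (l : List (Fin A)) : (ofList p l).visited.length ≤ p := by
  refine ofList_induction (P := fun x _ => x.visited.length ≤ p) (Nat.zero_le _) ?_ l
  intro x n a hx
  exact step_cases (P := fun y => y.visited.length ≤ p) x a (fun _ => hx) (fun _ _ _ => hx)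
    (fun hr _ => hr.2) (fun _ => hx)

theorem base_mem (l : List (Fin A)) : (ofList p l).base ∈ ∅ :: (ofList p l).visited := by
  refine ofList_induction (P := fun x _ => x.base ∈ ∅ :: x.visited) (by simp [init]) ?_ l
  intro x n a hx
  exact step_cases (P := fun y => y.base ∈ ∅ :: y.visited) x a (fun _ => hx) (fun _ _ _ => hx)
    (fun _ _ => by simp) (fun _ => hx)

/-- A phase takes at most `p + 1` actions. -/
theorem length_lt_of_running (l : List (Fin A)) (h : (ofList p l).Running) :
    l.length < p * (p + 1) := by
  have key : (ofList p l).Running →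
      l.length ≤ (ofList p l).visited.length * (p + 1) + (ofList p l).flipped.card := by
    refine ofList_induction (P := fun x n => x.Running →
      n ≤ x.visited.length * (p + 1) + x.flipped.card) (by simp) ?_ l
    intro x n a hx
    refine step_cases (P := fun y => y.Running →
      n + 1 ≤ y.visited.length * (p + 1) + y.flipped.card) x a (fun h1 h2 => absurd h2 h1)
      (fun hr ha hf _ => ?_) (fun hr _ _ => ?_) (fun _ h => by simp [Running] at h)
    · have := hx hr
      simp only
      rw [Finset.card_insert_of_notMem hf]
      omega
    · have := hx hr
      have h3 : x.flipped.card ≤ p := by simpa using x.flipped.card_le_univ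
      simp only [List.length_cons, add_mul, Finset.card_empty]
      omega
  have h1 := key h
  have h3 : (ofList p l).flipped.card ≤ p := by
    simpa using (ofList p l).flipped.card_le_univ
  have h4 : (ofList p l).visited.length + 1 ≤ p := h.2
  have h5 := Nat.mul_le_mul_right (p + 1) h4
  rw [add_mul] at h5
  omega

/-- The rewards at the end of the game are exponentially small. -/
theorem value_le_of_not_running (l : List (Fin A)) (h : ¬ (ofList p l).Running)
    (u : Finset (Fin p)) : (ofList p l).value u ≤ (25 / 32) ^ p := by
  by_cases hl : (ofList p l).legal = true
  · have h1 : p ≤ (ofList p l).visited.length := not_lt.1 fun hn => h ⟨hl, hn⟩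
    exact (value_le_factor (factor_mem l).1 u).trans ((factor_mem l).2.trans
      (pow_le_pow_of_le_one (by norm_num) (by norm_num) h1))
  · have : (ofList p l).value u = 0 := by simp [value, hl]
    rw [this]
    positivity

theorem le_card_base (l : List (Fin A)) (u : Finset (Fin p)) (hu : p ≤ 4 * u.card)
    (h : (ofList p l).Alive u) : p ≤ 4 * ((ofList p l).base ∆ u).card := by
  rcases List.mem_cons.1 (base_mem (p := p) l) with hb | hb
  · rw [hb, ← Finset.bot_eq_empty, bot_symmDiff]
    exact hu
  · exact h.2 _ hb

theorem value_init (u : Finset (Fin p)) : (init p).value u = decay (u.card / p) := by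
  simp only [value, init, if_true, Finset.empty_union, Finset.empty_sdiff, one_mul]
  rw [← Finset.bot_eq_empty, bot_symmDiff]
  simp [decay_zero]

end Conf

/-! ### MDPs on the tree of action sequences -/

section Tree

variable {H A : ℕ}

/-- The states are the sequences of fewer than `H` actions, and a final state. -/
@[reducible] def treeSpace (A H : ℕ) : StateSpace H where
  State := Option {l : List (Fin A) // l.length < H}
  finite := by
    have : Finite {l : List (Fin A) // l.length < H} := List.finite_length_lt (Fin A) H
    infer_instance
  bot := none
  stage s := s.elim H fun l => l.1.length
  stage_le s := by
    cases s with
    | none => exact le_rfl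
    | some l => exact l.2.le
  stage_eq_iff s := by
    cases s with
    | none => simp
    | some l => simpa using l.2.ne

/-- The state of a sequence of actions, which is the final one for sequences too long. -/
def treeState (H : ℕ) (l : List (Fin A)) : (treeSpace A H).State :=
  if h : l.length < H then some ⟨l, h⟩ else none

open Classical in
/-- Appends an action if `go` allows it, and moves to the final state otherwise. -/
def treeNext (go : List (Fin A) → Fin A → Prop) :
    (treeSpace A H).State → Fin A → (treeSpace A H).State
  | none, _ => none
  | some l, a => if go l.1 a then treeState H (l.1 ++ [a]) else none

open Classical in
/-- The model in which appending actions is not rewarded, and in which stopping is rewarded with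
mean `r`. -/
def treeModel (H : ℕ) (go : List (Fin A) → Fin A → Prop) (r : List (Fin A) → Fin A → ℝ)
    (hr : ∀ l a, r l a ∈ Set.Icc (0 : ℝ) 1) : DetModel (treeSpace A H) A where
  next := treeNext go
  rew s a := s.elim 0 fun l => if go l.1 a then 0 else r l.1 a
  rew_mem s a := by
    cases s with
    | none => simp
    | some l =>
      simp only [Option.elim]
      split_ifs
      · simp
      · exact hr _ _
  next_stage s hs a := by
    cases s with
    | none => exact absurd rfl hs
    | some l =>
      simp only [treeNext, treeState]
      split_ifs with h1 h2
      · exact Or.inr (by simp)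
      · exact Or.inl rfl
      · exact Or.inl rfl
  next_bot a := rfl
  rew_bot a := rfl
  next_of_rew s a h := by
    cases s with
    | none => rfl
    | some l =>
      simp only [Option.elim, ne_eq, ite_eq_left_iff, Classical.not_imp] at h
      simp [treeNext, h.1]

theorem treeModel_next_of_go {go : List (Fin A) → Fin A → Prop} {r : List (Fin A) → Fin A → ℝ}
    {hr : ∀ l a, r l a ∈ Set.Icc (0 : ℝ) 1} {l : {l : List (Fin A) // l.length < H}} {a : Fin A}
    (h : go l.1 a) : (treeModel H go r hr).next (some l) a = treeState H (l.1 ++ [a]) :=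
  if_pos h

theorem treeModel_next_of_not_go {go : List (Fin A) → Fin A → Prop}
    {r : List (Fin A) → Fin A → ℝ} {hr : ∀ l a, r l a ∈ Set.Icc (0 : ℝ) 1}
    {l : {l : List (Fin A) // l.length < H}} {a : Fin A}
    (h : ¬ go l.1 a) : (treeModel H go r hr).next (some l) a = none :=
  if_neg h

theorem treeModel_rew_of_go {go : List (Fin A) → Fin A → Prop} {r : List (Fin A) → Fin A → ℝ}
    {hr : ∀ l a, r l a ∈ Set.Icc (0 : ℝ) 1} {l : {l : List (Fin A) // l.length < H}} {a : Fin A}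
    (h : go l.1 a) : (treeModel H go r hr).rew (some l) a = 0 :=
  if_pos h

theorem treeModel_rew_of_not_go {go : List (Fin A) → Fin A → Prop}
    {r : List (Fin A) → Fin A → ℝ} {hr : ∀ l a, r l a ∈ Set.Icc (0 : ℝ) 1}
    {l : {l : List (Fin A) // l.length < H}} {a : Fin A}
    (h : ¬ go l.1 a) : (treeModel H go r hr).rew (some l) a = r l.1 a :=
  if_neg h

/-- A value function on action sequences, extended to the final state by `0`. -/
def treeValue (v : List (Fin A) → ℝ) (s : (treeSpace A H).State) : ℝ≥0∞ :=
  s.elim 0 fun l => ENNReal.ofReal (v l.1)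

theorem backup_treeModel {go : List (Fin A) → Fin A → Prop} {r : List (Fin A) → Fin A → ℝ}
    {hr : ∀ l a, r l a ∈ Set.Icc (0 : ℝ) 1} {v : List (Fin A) → ℝ}
    (hgo : ∀ l a, go l a → (l ++ [a]).length < H)
    (hv : ∀ l a, go l a → v (l ++ [a]) = r l a)
    (l : {l : List (Fin A) // l.length < H}) (a : Fin A) :
    (treeModel H go r hr).toMDP.backup (treeValue v) (some l) a = ENNReal.ofReal (r l.1 a) := by
  refine (DetModel.backup_toMDP _ _ _ _).trans ?_
  by_cases h : go l.1 a
  · rw [treeModel_next_of_go h, treeModel_rew_of_go h, ENNReal.ofReal_zero, zero_add,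
      treeState, dif_pos (hgo _ _ h), ← hv _ _ h]
    rfl
  · rw [treeModel_next_of_not_go h, treeModel_rew_of_not_go h]
    exact add_zero _

theorem backup_treeModel_bot {go : List (Fin A) → Fin A → Prop} {r : List (Fin A) → Fin A → ℝ}
    {hr : ∀ l a, r l a ∈ Set.Icc (0 : ℝ) 1} {v : List (Fin A) → ℝ} (a : Fin A) :
    (treeModel H go r hr).toMDP.backup (treeValue v) none a = 0 := by
  refine (DetModel.backup_toMDP _ _ _ _).trans ?_
  change ENNReal.ofReal 0 + 0 = 0
  simp

variable {go : List (Fin A) → Fin A → Prop} {r : List (Fin A) → Fin A → ℝ}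
    {hr : ∀ l a, r l a ∈ Set.Icc (0 : ℝ) 1} {v : List (Fin A) → ℝ}

/-- A value function that satisfies the Bellman equations for the mean payoffs `r`. -/
structure IsTreeSolution (H : ℕ) (go : List (Fin A) → Fin A → Prop)
    (r : List (Fin A) → Fin A → ℝ) (v : List (Fin A) → ℝ) : Prop where
  length_lt : ∀ l a, go l a → (l ++ [a]).length < H
  child : ∀ l a, go l a → v (l ++ [a]) = r l a
  le : ∀ l a, r l a ≤ v l
  exists_eq : ∀ l, ∃ a, r l a = v l

theorem IsTreeSolution.bellman (h : IsTreeSolution H go r v) :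
    (∀ s a, (treeModel H go r hr).toMDP.backup (treeValue v) s a ≤ treeValue v s) ∧
      ∀ s, ∃ a, (treeModel H go r hr).toMDP.backup (treeValue v) s a = treeValue v s := by
  constructor
  · rintro (_ | l) a
    · rw [backup_treeModel_bot]
      exact bot_le
    · rw [backup_treeModel h.length_lt h.child]
      exact ENNReal.ofReal_le_ofReal (h.le _ _)
  · rintro (_ | l)
    · obtain ⟨a, -⟩ := h.exists_eq []
      exact ⟨a, backup_treeModel_bot a⟩
    · obtain ⟨a, ha⟩ := h.exists_eq l.1
      refine ⟨a, ?_⟩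
      rw [backup_treeModel h.length_lt h.child, ha]
      rfl

theorem IsTreeSolution.vStar_eq (h : IsTreeSolution H go r v) (s : (treeSpace A H).State) :
    (treeModel H go r hr).toMDP.vStar s = treeValue v s :=
  MDP.vStar_eq (treeModel H go r hr).toMDP (treeValue v) rfl h.bellman.1 h.bellman.2 s

theorem IsTreeSolution.qStar_some (h : IsTreeSolution H go r v)
    (l : {l : List (Fin A) // l.length < H}) (a : Fin A) :
    (treeModel H go r hr).toMDP.qStar (some l) a = ENNReal.ofReal (r l.1 a) :=
  (MDP.qStar_eq (treeModel H go r hr).toMDP ((Nat.zero_le _).trans_lt l.2) (treeValue v) rfl h.bellman.1 h.bellman.2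
    (some l) a).trans (backup_treeModel h.length_lt h.child l a)

theorem IsTreeSolution.qStar_none (hH : 0 < H) (h : IsTreeSolution H go r v) (a : Fin A) :
    (treeModel H go r hr).toMDP.qStar none a = 0 :=
  (MDP.qStar_eq (treeModel H go r hr).toMDP hH (treeValue v) rfl h.bellman.1 h.bellman.2 none a).trans
    (backup_treeModel_bot a)

end Tree

/-! ### The hard family -/

section Game

variable {H A p : ℕ}

/-- The game with secret vertex `u` goes on when `a` is appended to `l`. -/
def aliveStep (u : Finset (Fin p)) (l : List (Fin A)) (a : Fin A) : Prop :=
  (Conf.ofList p l).Alive u ∧ (Conf.ofList p (l ++ [a])).Alive u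

/-- The game of the reward-free reference model goes on when `a` is appended to `l`. -/
def runningStep (p : ℕ) (l : List (Fin A)) (a : Fin A) : Prop :=
  (Conf.ofList p l).Running ∧ (Conf.ofList p (l ++ [a])).Running

/-- Value of a sequence of actions when the secret vertex is `u`. -/
def seqValue (u : Finset (Fin p)) (l : List (Fin A)) : ℝ := (Conf.ofList p l).value u

open Classical in
/-- Payoffs that make the optimal state values equal to `seqValue` in all states: when the game
is already over, every action pays the value of the state. -/
def statePayoff (u : Finset (Fin p)) (l : List (Fin A)) (a : Fin A) : ℝ :=
  if (Conf.ofList p l).Alive u then seqValue u (l ++ [a]) else seqValue u l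

/-- Payoffs that make the optimal action values equal to `seqValue` in all states. -/
def actionPayoff (u : Finset (Fin p)) (l : List (Fin A)) (a : Fin A) : ℝ := seqValue u (l ++ [a])

theorem seqValue_mem (u : Finset (Fin p)) (l : List (Fin A)) : seqValue u l ∈ Set.Icc (0 : ℝ) 1 :=
  Conf.value_mem l u

theorem statePayoff_mem (u : Finset (Fin p)) (l : List (Fin A)) (a : Fin A) :
    statePayoff u l a ∈ Set.Icc (0 : ℝ) 1 := by
  unfold statePayoff; split_ifs <;> exact seqValue_mem _ _

theorem actionPayoff_mem (u : Finset (Fin p)) (l : List (Fin A)) (a : Fin A) :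
    actionPayoff u l a ∈ Set.Icc (0 : ℝ) 1 := seqValue_mem _ _

theorem seqValue_concat_le {u : Finset (Fin p)} {l : List (Fin A)}
    (h : (Conf.ofList p l).Alive u) (a : Fin A) : seqValue u (l ++ [a]) ≤ seqValue u l := by
  unfold seqValue
  rw [Conf.ofList_concat]
  exact Conf.value_step_le h.1 (Conf.factor_mem l).1 _ _

theorem exists_seqValue_concat_eq (hA : p ≤ A) {u : Finset (Fin p)} (hu : p ≤ 4 * u.card)
    {l : List (Fin A)} (h : (Conf.ofList p l).Alive u) :
    ∃ a, seqValue u (l ++ [a]) = seqValue u l := by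
  obtain ⟨a, ha, h1⟩ := Conf.exists_value_step_eq h.1 u (Conf.le_card_base l u hu h)
  refine ⟨⟨a, ha.trans_le hA⟩, ?_⟩
  unfold seqValue
  rw [Conf.ofList_concat]
  exact h1

theorem length_lt_of_aliveStep (hH : p * (p + 1) ≤ H) {u : Finset (Fin p)} {l : List (Fin A)}
    {a : Fin A} (h : aliveStep u l a) : (l ++ [a]).length < H :=
  (Conf.length_lt_of_running _ h.2.1).trans_le hH

theorem isTreeSolution_statePayoff (hp : 0 < p) (hA : p ≤ A) (hH : p * (p + 1) ≤ H)
    {u : Finset (Fin p)} (hu : p ≤ 4 * u.card) :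
    IsTreeSolution H (aliveStep (A := A) u) (statePayoff u) (seqValue u) where
  length_lt _ _ h := length_lt_of_aliveStep hH h
  child l a h := (if_pos h.1).symm
  le l a := by
    unfold statePayoff
    split_ifs with h
    · exact seqValue_concat_le h a
    · exact le_rfl
  exists_eq l := by
    by_cases h : (Conf.ofList p l).Alive u
    · obtain ⟨a, ha⟩ := exists_seqValue_concat_eq hA hu h
      exact ⟨a, (if_pos h).trans ha⟩
    · exact ⟨⟨0, hp.trans_le hA⟩, if_neg h⟩

open Classical in
/-- Optimal state values for the payoffs `actionPayoff`. -/
def maxValue (u : Finset (Fin p)) (l : List (Fin A)) : ℝ :=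
  if (Conf.ofList p l).Alive u then seqValue u l else ⨆ a, seqValue u (l ++ [a])

theorem isTreeSolution_actionPayoff (hp : 0 < p) (hA : p ≤ A) (hH : p * (p + 1) ≤ H)
    {u : Finset (Fin p)} (hu : p ≤ 4 * u.card) :
    IsTreeSolution H (aliveStep (A := A) u) (actionPayoff u) (maxValue u) where
  length_lt _ _ h := length_lt_of_aliveStep hH h
  child l a h := if_pos h.2
  le l a := by
    unfold maxValue
    split_ifs with h
    · exact seqValue_concat_le h a
    · exact le_ciSup (f := fun a => seqValue u (l ++ [a])) (Set.finite_range _).bddAbove a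
  exists_eq l := by
    by_cases h : (Conf.ofList p l).Alive u
    · obtain ⟨a, ha⟩ := exists_seqValue_concat_eq hA hu h
      exact ⟨a, ha.trans (if_pos h).symm⟩
    · have : Nonempty (Fin A) := ⟨⟨0, hp.trans_le hA⟩⟩
      obtain ⟨a, ha⟩ := exists_eq_ciSup_of_finite (f := fun a => seqValue u (l ++ [a]))
      exact ⟨a, ha.trans (if_neg h).symm⟩

theorem alive_nil (hp : 0 < p) (u : Finset (Fin p)) :
    (Conf.ofList p ([] : List (Fin A))).Alive u :=
  ⟨⟨rfl, hp⟩, by simp [Conf.ofList, Conf.init]⟩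

theorem seqValue_nil (u : Finset (Fin p)) :
    seqValue u ([] : List (Fin A)) = decay (u.card / p) := Conf.value_init u

/-- All reachable states are final or alive. -/
theorem alive_of_reachable (hp : 0 < p) {u : Finset (Fin p)} {r : List (Fin A) → Fin A → ℝ}
    {hr : ∀ l a, r l a ∈ Set.Icc (0 : ℝ) 1} {s : (treeSpace A H).State}
    (h : (treeModel H (aliveStep u) r hr).toMDP.Reachable s) :
    s = none ∨ ∃ l, s = some l ∧ (Conf.ofList p l.1).Alive u := by
  refine DetModel.reachable_induction _ (P := fun s => s = none ∨ ∃ l, s = some l ∧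
    (Conf.ofList p l.1).Alive u) ?_ ?_ h
  · rintro (_ | l) hs
    · exact Or.inl rfl
    · refine Or.inr ⟨l, rfl, ?_⟩
      have h1 : l.1.length = 0 := hs
      rw [List.length_eq_zero_iff.1 h1]
      exact alive_nil hp u
  · rintro (_ | l) a -
    · exact Or.inl rfl
    · by_cases hg : aliveStep u l.1 a
      · rw [treeModel_next_of_go hg, treeState]
        split_ifs with hl
        · exact Or.inr ⟨_, rfl, hg.2⟩
        · exact Or.inl rfl
      · exact Or.inl (treeModel_next_of_not_go hg)

theorem treeNext_runningStep (hH : p * (p + 1) ≤ H) (s : (treeSpace A H).State) (a : Fin A)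
    (hs : s ≠ (treeSpace A H).bot) :
    treeNext (runningStep p) s a = (treeSpace A H).bot ∨
      ((treeSpace A H).stage (treeNext (runningStep p) s a) = (treeSpace A H).stage s + 1 ∧
        (treeSpace A H).stage (treeNext (runningStep p) s a) < p * (p + 1)) := by
  cases s with
  | none => exact absurd rfl hs
  | some l =>
    by_cases h : runningStep p l.1 a
    · refine Or.inr ?_
      have h1 := Conf.length_lt_of_running _ h.2
      have h2 : treeNext (runningStep p) (some l) a = some ⟨l.1 ++ [a], h1.trans_le hH⟩ := by
        simp only [treeNext, if_pos h, treeState]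
        exact dif_pos _
      rw [h2]
      exact ⟨by simp, h1⟩
    · exact Or.inl (by simp [treeNext, h])

open Classical in
/-- A response can be revealing only because a vertex visited is close to the secret one, or
with exponentially small probability at the end of the game. -/
theorem revealProb_le {u : Finset (Fin p)} {r : List (Fin A) → Fin A → ℝ}
    {hr : ∀ l a, r l a ∈ Set.Icc (0 : ℝ) 1}
    (hsmall : ∀ l a, ¬ aliveStep u l a → (∀ v ∈ (Conf.ofList p (l ++ [a])).visited,
      p ≤ 4 * (v ∆ u).card) → r l a ≤ (25 / 32) ^ p)
    (l : {l : List (Fin A) // l.length < H}) (a : Fin A) :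
    revealProb (treeModel H (aliveStep u) r hr).kernel (treeNext (runningStep p)) (some l, a) ≤
      ∑ v ∈ (Conf.ofList p (l.1 ++ [a])).visited.toFinset,
        (if 4 * (v ∆ u).card < p then 1 else 0) + ENNReal.ofReal ((25 / 32) ^ p) := by
  by_cases hv : ∀ v ∈ (Conf.ofList p (l.1 ++ [a])).visited, p ≤ 4 * (v ∆ u).card
  · refine le_add_left ?_
    have hv' : ∀ v ∈ (Conf.ofList p l.1).visited, p ≤ 4 * (v ∆ u).card := fun v h => by
      refine hv v ?_
      rw [Conf.ofList_concat]
      exact Conf.visited_step_subset _ _ h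
    have hgo : aliveStep u l.1 a ↔ runningStep p l.1 a :=
      ⟨fun h => ⟨h.1.1, h.2.1⟩, fun h => ⟨⟨h.1, hv'⟩, ⟨h.2, hv⟩⟩⟩
    have hnext : treeNext (runningStep p) (some l) a =
        (treeModel H (aliveStep u) r hr).next (some l) a := by
      simp only [treeModel, treeNext, hgo]
    refine ((treeModel H (aliveStep u) r hr).revealProb_le_rew (treeNext (runningStep p))
      (some l, a) hnext.symm).trans (ENNReal.ofReal_le_ofReal ?_)
    by_cases hg : aliveStep u l.1 a
    · rw [treeModel_rew_of_go hg]
      positivity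
    · rw [treeModel_rew_of_not_go hg]
      exact hsmall _ _ hg hv
  · push Not at hv
    obtain ⟨v, hv, hvu⟩ := hv
    refine le_add_right (le_trans ?_ (Finset.single_le_sum (f := fun v : Finset (Fin p) =>
      if 4 * (v ∆ u).card < p then (1 : ℝ≥0∞) else 0) (fun _ _ => bot_le)
      (List.mem_toFinset.2 hv)))
    rw [if_pos hvu]
    exact DetModel.revealProb_le_one (treeModel H (aliveStep u) r hr) (treeNext (runningStep p))
      (some l, a)

theorem actionPayoff_small {u : Finset (Fin p)} (l : List (Fin A)) (a : Fin A)
    (h : ¬ aliveStep u l a)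
    (hv : ∀ v ∈ (Conf.ofList p (l ++ [a])).visited, p ≤ 4 * (v ∆ u).card) :
    actionPayoff u l a ≤ (25 / 32) ^ p := by
  refine Conf.value_le_of_not_running _ (fun hr => h ?_) u
  have hr' : (Conf.ofList p l).Running := by
    by_contra hn
    rw [Conf.ofList_concat, Conf.step_of_not_running hn] at hr
    exact hn hr
  refine ⟨⟨hr', fun v h => hv v ?_⟩, hr, hv⟩
  rw [Conf.ofList_concat]
  exact Conf.visited_step_subset _ _ h

theorem statePayoff_small {u : Finset (Fin p)} (l : List (Fin A)) (a : Fin A)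
    (h : ¬ aliveStep u l a)
    (hv : ∀ v ∈ (Conf.ofList p (l ++ [a])).visited, p ≤ 4 * (v ∆ u).card) :
    statePayoff u l a ≤ (25 / 32) ^ p := by
  unfold statePayoff
  split_ifs with hl
  · exact actionPayoff_small l a h hv
  · refine Conf.value_le_of_not_running _ (fun hr => hl ⟨hr, fun v h => hv v ?_⟩) u
    rw [Conf.ofList_concat]
    exact Conf.visited_step_subset _ _ h

end Game

/-! ### Linear features -/

section Features

variable {p d : ℕ}

/-- Tensor of the quadratic form that agrees with `decay ⟨a, y⟩` when `y none = 1`. -/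
def decayTensor (a : Option (Fin p) → ℝ) (q : Option (Fin p) × Option (Fin p)) : ℝ :=
  (if q.1 = none then 1 else 0) * (if q.2 = none then 1 else 0) -
    (if q.1 = none then 1 else 0) * a q.2 + a q.1 * a q.2 / 2

theorem sum_decayTensor_mul (a y : Option (Fin p) → ℝ) (hy : y none = 1) :
    ∑ q, decayTensor a q * (y q.1 * y q.2) = decay (∑ i, a i * y i) := by
  have h1 : ∑ i : Option (Fin p), (if i = none then 1 else 0) * y i = 1 := by
    simp [hy]
  have h2 : ∀ f g : Option (Fin p) → ℝ,
      ∑ q : Option (Fin p) × Option (Fin p), (f q.1 * y q.1) * (g q.2 * y q.2) =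
        (∑ i, f i * y i) * ∑ i, g i * y i := fun f g => by
    rw [Fintype.sum_prod_type, Finset.sum_mul_sum]
  have h3 : ∀ q : Option (Fin p) × Option (Fin p), decayTensor a q * (y q.1 * y q.2) =
      ((if q.1 = none then 1 else 0) * y q.1) * ((if q.2 = none then 1 else 0) * y q.2) -
      ((if q.1 = none then 1 else 0) * y q.1) * (a q.2 * y q.2) +
      (a q.1 * y q.1) * (a q.2 * y q.2) / 2 := fun q => by
    unfold decayTensor; ring
  simp_rw [h3]
  rw [Finset.sum_add_distrib, Finset.sum_sub_distrib, ← Finset.sum_div,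
    h2 (fun i => if i = none then 1 else 0) (fun i => if i = none then 1 else 0),
    h2 (fun i => if i = none then 1 else 0) a, h2 a a, h1, decay]
  ring

theorem sum_decayTensor_sq_le (a : Option (Fin p) → ℝ) (ha : ∑ i, a i ^ 2 ≤ 5 / 4) :
    ∑ q, decayTensor a q ^ 2 ≤ 8 := by
  have h2 : ∀ f g : Option (Fin p) → ℝ,
      ∑ q : Option (Fin p) × Option (Fin p), f q.1 ^ 2 * g q.2 ^ 2 =
        (∑ i, f i ^ 2) * ∑ i, g i ^ 2 := fun f g => by
    rw [Fintype.sum_prod_type, Finset.sum_mul_sum]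
  have h1 : ∑ i : Option (Fin p), (if i = none then (1 : ℝ) else 0) ^ 2 = 1 := by
    simp
  have h3 : ∀ q : Option (Fin p) × Option (Fin p), decayTensor a q ^ 2 ≤
      3 * (((if q.1 = none then 1 else 0) ^ 2 * (if q.2 = none then 1 else 0) ^ 2) +
      ((if q.1 = none then 1 else 0) ^ 2 * a q.2 ^ 2) +
      (a q.1 ^ 2 * a q.2 ^ 2) / 4) := fun q => by
    unfold decayTensor
    generalize (if q.1 = none then (1 : ℝ) else 0) = s
    generalize (if q.2 = none then (1 : ℝ) else 0) = t
    nlinarith [sq_nonneg (s * t + s * a q.2), sq_nonneg (s * t - a q.1 * a q.2 / 2),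
      sq_nonneg (s * a q.2 + a q.1 * a q.2 / 2)]
  refine (Finset.sum_le_sum fun q _ => h3 q).trans ?_
  rw [← Finset.mul_sum, Finset.sum_add_distrib, Finset.sum_add_distrib, ← Finset.sum_div,
    h2 (fun i => if i = none then 1 else 0) (fun i => if i = none then 1 else 0),
    h2 (fun i => if i = none then 1 else 0) a, h2 a a, h1]
  have h0 : 0 ≤ ∑ i, a i ^ 2 := Finset.sum_nonneg fun i _ => sq_nonneg _
  nlinarith

/-- The sign of a bit. -/
def bitSign (u : Finset (Fin p)) (i : Fin p) : ℝ := if i ∈ u then 1 else -1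

/-- The affine coordinates of a vertex, scaled such that their norm does not depend on `p`. -/
def coords (u : Finset (Fin p)) : Option (Fin p) → ℝ
  | none => 1
  | some i => bitSign u i / √p

theorem bitSign_sq (u : Finset (Fin p)) (i : Fin p) : bitSign u i ^ 2 = 1 := by
  unfold bitSign; split_ifs <;> norm_num

theorem sum_coords_sq_le (u : Finset (Fin p)) : ∑ i, coords u i ^ 2 ≤ 2 := by
  rw [Fintype.sum_option]
  simp only [coords, div_pow, bitSign_sq, Real.sq_sqrt (Nat.cast_nonneg p)]
  simp only [Finset.sum_const, Finset.card_univ, Fintype.card_fin, nsmul_eq_mul]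
  have : (p : ℝ) * (1 / p) ≤ 1 := by
    rw [mul_one_div]
    exact div_self_le_one _
  linarith

/-- The functional with `⟨unionForm x, coords u⟩ = |flipped ∪ (base ∆ u)| / p`. -/
def unionForm (x : Conf p) : Option (Fin p) → ℝ
  | none => (∑ i, if i ∈ x.flipped then 1 else 1 / 2) / p
  | some i => (if i ∈ x.flipped then 0 else - bitSign x.base i / 2) / √p

/-- The functional with `⟨sdiffForm x, coords u⟩ = |flipped \ (base ∆ u)| / p`. -/
def sdiffForm (x : Conf p) : Option (Fin p) → ℝ
  | none => (∑ i, if i ∈ x.flipped then 1 / 2 else 0) / p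
  | some i => (if i ∈ x.flipped then bitSign x.base i / 2 else 0) / √p

theorem card_div_eq_sum (s : Finset (Fin p)) :
    (s.card : ℝ) / p = (∑ i, if i ∈ s then 1 else 0) / p := by
  simp

theorem sum_form_mul_coords (c b : Fin p → ℝ) (u : Finset (Fin p)) :
    (∑ i, c i) / p * 1 + ∑ i, b i / √p * (bitSign u i / √p) =
      (∑ i, (c i + b i * bitSign u i)) / p := by
  have h : ∀ i, b i / √p * (bitSign u i / √p) = b i * bitSign u i / p := fun i => by
    rw [div_mul_div_comm, Real.mul_self_sqrt (Nat.cast_nonneg p)]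
  simp only [h]
  rw [Finset.sum_add_distrib, add_div, mul_one, ← Finset.sum_div]

theorem sum_unionForm_mul (x : Conf p) (u : Finset (Fin p)) :
    ∑ i, unionForm x i * coords u i = ((x.flipped ∪ (x.base ∆ u)).card : ℝ) / p := by
  rw [Fintype.sum_option, card_div_eq_sum]
  refine (sum_form_mul_coords _ _ u).trans ?_
  congr 1
  refine Finset.sum_congr rfl fun i _ => ?_
  by_cases h1 : i ∈ x.flipped <;> by_cases h2 : i ∈ x.base <;> by_cases h3 : i ∈ u <;>
    norm_num [h1, h2, h3, bitSign, Finset.mem_symmDiff]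

theorem sum_sdiffForm_mul (x : Conf p) (u : Finset (Fin p)) :
    ∑ i, sdiffForm x i * coords u i = ((x.flipped \ (x.base ∆ u)).card : ℝ) / p := by
  rw [Fintype.sum_option, card_div_eq_sum]
  refine (sum_form_mul_coords _ _ u).trans ?_
  congr 1
  refine Finset.sum_congr rfl fun i _ => ?_
  by_cases h1 : i ∈ x.flipped <;> by_cases h2 : i ∈ x.base <;> by_cases h3 : i ∈ u <;>
    norm_num [h1, h2, h3, bitSign, Finset.mem_symmDiff]

theorem sum_form_sq_le (c b : Fin p → ℝ) (hc : ∀ i, c i ∈ Set.Icc (0 : ℝ) 1)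
    (hb : ∀ i, b i ^ 2 ≤ 1 / 4) :
    ((∑ i, c i) / p) ^ 2 + ∑ i, (b i / √p) ^ 2 ≤ 5 / 4 := by
  have h1 : (∑ i, c i) / p ≤ 1 := by
    refine div_le_one_of_le₀ ?_ (Nat.cast_nonneg p)
    calc ∑ i, c i ≤ ∑ _i : Fin p, 1 := Finset.sum_le_sum fun i _ => (hc i).2
      _ = p := by simp
  have h0 : 0 ≤ (∑ i, c i) / p := div_nonneg (Finset.sum_nonneg fun i _ => (hc i).1) (by simp)
  have h2 : ∑ i, (b i / √p) ^ 2 ≤ 1 / 4 := by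
    simp only [div_pow, Real.sq_sqrt (Nat.cast_nonneg p)]
    rw [← Finset.sum_div]
    refine div_le_of_le_mul₀ (Nat.cast_nonneg p) (by norm_num) ?_
    calc ∑ i, b i ^ 2 ≤ ∑ _i : Fin p, 1 / 4 := Finset.sum_le_sum fun i _ => hb i
      _ = 1 / 4 * p := by simp [mul_comm]
  nlinarith

theorem sum_unionForm_sq_le (x : Conf p) : ∑ i, unionForm x i ^ 2 ≤ 5 / 4 := by
  rw [Fintype.sum_option]
  refine sum_form_sq_le _ _ (fun i => ?_) fun i => ?_
  · split_ifs <;> norm_num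
  · split_ifs
    · norm_num
    · rw [neg_div, neg_sq, div_pow, bitSign_sq]; norm_num

theorem sum_sdiffForm_sq_le (x : Conf p) : ∑ i, sdiffForm x i ^ 2 ≤ 5 / 4 := by
  rw [Fintype.sum_option]
  refine sum_form_sq_le _ _ (fun i => ?_) fun i => ?_
  · split_ifs <;> norm_num
  · split_ifs
    · rw [div_pow, bitSign_sq]; norm_num
    · norm_num

/-- Index set of the tensors of order four over the affine coordinates. -/
abbrev TensorIndex (p : ℕ) : Type :=
  (Option (Fin p) × Option (Fin p)) × (Option (Fin p) × Option (Fin p))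

/-- A tensor as a Euclidean vector, padded with zeros. -/
def tensorVec (e : TensorIndex p ↪ Fin d) (g : TensorIndex p → ℝ) : EuclideanSpace ℝ (Fin d) :=
  WithLp.toLp 2 (Function.extend e g 0)

theorem inner_tensorVec (e : TensorIndex p ↪ Fin d) (g g' : TensorIndex p → ℝ) :
    inner ℝ (tensorVec e g) (tensorVec e g') = ∑ q, g q * g' q := by
  rw [PiLp.inner_apply]
  symm
  refine Fintype.sum_of_injective e e.injective _ _ (fun k hk => ?_) fun q => ?_
  · have : tensorVec e g k = 0 := Function.extend_apply' _ _ _ (by simpa using hk)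
    simp [this]
  · have h : ∀ g : TensorIndex p → ℝ, tensorVec e g (e q) = g q :=
      fun g => e.injective.extend_apply _ _ _
    simp [h, mul_comm]

theorem sum_tensor_mul (f g f' g' : Option (Fin p) × Option (Fin p) → ℝ) :
    ∑ q : TensorIndex p, (f q.1 * g q.2) * (f' q.1 * g' q.2) =
      (∑ q, f q * f' q) * ∑ q, g q * g' q := by
  rw [Fintype.sum_prod_type, Finset.sum_mul_sum]
  refine Finset.sum_congr rfl fun i _ => Finset.sum_congr rfl fun j _ => ?_
  ring

theorem norm_tensorVec_le (e : TensorIndex p ↪ Fin d)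
    (f g : Option (Fin p) × Option (Fin p) → ℝ) {a b : ℝ} (c : ℝ) (hc : 0 ≤ c)
    (ha : ∑ q, f q ^ 2 ≤ a) (hb : ∑ q, g q ^ 2 ≤ b) (hab : a * b ≤ c ^ 2) :
    ‖tensorVec e (fun q => f q.1 * g q.2)‖ ≤ c := by
  refine abs_le_of_sq_le_sq' ?_ hc |>.2
  rw [← real_inner_self_eq_norm_sq, inner_tensorVec, sum_tensor_mul]
  simp only [← sq]
  refine le_trans (mul_le_mul ha hb (Finset.sum_nonneg fun _ _ => sq_nonneg _) ?_) hab
  exact (Finset.sum_nonneg fun _ _ => sq_nonneg _).trans ha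

/-- The feature vector of a configuration. -/
def confFeature (e : TensorIndex p ↪ Fin d) (x : Conf p) : EuclideanSpace ℝ (Fin d) :=
  ((if x.legal then x.factor else 0) / 8) •
    tensorVec e (fun q => decayTensor (unionForm x) q.1 * decayTensor (sdiffForm x) q.2)

/-- The parameter vector of a secret vertex. -/
def secretVec (e : TensorIndex p ↪ Fin d) (u : Finset (Fin p)) : EuclideanSpace ℝ (Fin d) :=
  (8 : ℝ) • tensorVec e
    (fun q => (coords u q.1.1 * coords u q.1.2) * (coords u q.2.1 * coords u q.2.2))

theorem inner_confFeature (e : TensorIndex p ↪ Fin d) (x : Conf p) (u : Finset (Fin p)) :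
    inner ℝ (confFeature e x) (secretVec e u) = x.value u := by
  rw [confFeature, secretVec, inner_smul_left, inner_smul_right, inner_tensorVec,
    sum_tensor_mul (decayTensor (unionForm x)) (decayTensor (sdiffForm x))
      (fun q => coords u q.1 * coords u q.2) (fun q => coords u q.1 * coords u q.2),
    sum_decayTensor_mul _ _ rfl, sum_decayTensor_mul _ _ rfl, sum_unionForm_mul,
    sum_sdiffForm_mul, Conf.value]
  split_ifs
  · simp only [conj_trivial]
    ring
  · simp

theorem norm_confFeature_le (e : TensorIndex p ↪ Fin d) {x : Conf p}
    (hx : x.factor ∈ Set.Icc (0 : ℝ) 1) : ‖confFeature e x‖ ≤ 1 := by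
  have h := norm_tensorVec_le e (decayTensor (unionForm x)) (decayTensor (sdiffForm x)) 8
    (by norm_num) (sum_decayTensor_sq_le _ (sum_unionForm_sq_le x))
    (sum_decayTensor_sq_le _ (sum_sdiffForm_sq_le x)) (by norm_num)
  have h2 : (if x.legal then x.factor else 0) ∈ Set.Icc (0 : ℝ) 1 := by
    split_ifs
    · exact hx
    · simp
  rw [confFeature, norm_smul, Real.norm_eq_abs, abs_of_nonneg (div_nonneg h2.1 (by norm_num))]
  have h3 := h2.2
  calc _ ≤ (1 / 8 : ℝ) * 8 := by gcongr
    _ = 1 := by norm_num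

theorem norm_secretVec_le (e : TensorIndex p ↪ Fin d) (u : Finset (Fin p)) :
    ‖secretVec e u‖ ≤ 32 := by
  have h4 : ∑ q : Option (Fin p) × Option (Fin p), (coords u q.1 * coords u q.2) ^ 2 ≤ 4 := by
    have h := sum_coords_sq_le u
    have h0 : 0 ≤ ∑ i, coords u i ^ 2 := Finset.sum_nonneg fun i _ => sq_nonneg _
    simp only [mul_pow]
    have h1 : ∑ q : Option (Fin p) × Option (Fin p), coords u q.1 ^ 2 * coords u q.2 ^ 2 =
        (∑ i, coords u i ^ 2) * ∑ i, coords u i ^ 2 := by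
      rw [Fintype.sum_prod_type, Finset.sum_mul_sum]
    rw [h1]
    nlinarith
  have h := norm_tensorVec_le e (fun q => coords u q.1 * coords u q.2)
    (fun q => coords u q.1 * coords u q.2) 4 (by norm_num) h4 h4 (by norm_num)
  rw [secretVec, norm_smul]
  norm_num
  linarith

theorem nonempty_tensorIndex_embedding (h : (p + 1) ^ 4 ≤ d) :
    Nonempty (TensorIndex p ↪ Fin d) := by
  refine Function.Embedding.nonempty_of_card_le ?_
  simp only [Fintype.card_prod, Fintype.card_option, Fintype.card_fin]
  refine le_trans (le_of_eq ?_) h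
  ring

end Features

/-! ### Counting close vertices -/

section Counting

variable {p : ℕ}

/-- Exponentially few vertices are at relative distance less than `1/4` from a given one. -/
theorem card_close_le (v : Finset (Fin p)) :
    ((Finset.univ.filter fun u => 4 * (v ∆ u).card < p).card : ℝ) ≤ (337 / 192) ^ p := by
  -- Each close vertex has weight at least `(3/4) ^ p` under the weights `(3/4) ^ (4 * distance)`.
  have h1 : ∑ u : Finset (Fin p), (81 / 256 : ℝ) ^ (v ∆ u).card = (337 / 256) ^ p := by
    have h2 := (symmDiff_right_involutive v).bijective.sum_comp
      (fun s : Finset (Fin p) => (81 / 256 : ℝ) ^ s.card)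
    rw [h2]
    have h3 := Fintype.sum_pow_mul_eq_add_pow (Fin p) (81 / 256 : ℝ) 1
    simp only [one_pow, mul_one, Fintype.card_fin] at h3
    rw [h3]
    norm_num
  have h4 : ((Finset.univ.filter fun u => 4 * (v ∆ u).card < p).card : ℝ) * (3 / 4) ^ p ≤
      (337 / 256) ^ p := by
    rw [← h1, ← nsmul_eq_mul, ← Finset.sum_const]
    refine le_trans (Finset.sum_le_sum fun u hu => ?_) (Finset.sum_le_sum_of_subset_of_nonneg
      (Finset.filter_subset _ _) fun _ _ _ => by positivity)
    have h5 : (81 / 256 : ℝ) = (3 / 4) ^ 4 := by norm_num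
    rw [h5, ← pow_mul]
    exact pow_le_pow_of_le_one (by norm_num) (by norm_num) (Finset.mem_filter.1 hu).2.le
  have h6 : (337 / 192 : ℝ) ^ p = (337 / 256) ^ p / (3 / 4) ^ p := by
    rw [← div_pow]; norm_num
  rw [h6, le_div_iff₀ (by positivity)]
  exact h4

/-- The possible secret vertices, those far from the initial vertex `∅`. -/
def secrets (p : ℕ) : Finset (Finset (Fin p)) := Finset.univ.filter fun u => p ≤ 4 * u.card

theorem le_card_secrets (p : ℕ) : (2 : ℝ) ^ p - (337 / 192) ^ p ≤ (secrets p).card := by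
  have h := card_close_le (∅ : Finset (Fin p))
  have h1 : (secrets p).card + (Finset.univ.filter fun u : Finset (Fin p) =>
      4 * ((∅ : Finset (Fin p)) ∆ u).card < p).card = 2 ^ p := by
    have h2 := Finset.card_filter_add_card_filter_not (s := (Finset.univ : Finset (Finset (Fin p))))
      (fun u => p ≤ 4 * u.card)
    rw [Finset.card_univ, Fintype.card_finset, Fintype.card_fin] at h2
    rw [← h2, secrets]
    congr 2
    ext u
    have hu : (∅ : Finset (Fin p)) ∆ u = u := bot_symmDiff u
    simp [hu]
  have h3 : ((secrets p).card : ℝ) + ((Finset.univ.filter fun u : Finset (Fin p) =>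
      4 * ((∅ : Finset (Fin p)) ∆ u).card < p).card : ℝ) = 2 ^ p := by exact_mod_cast h1
  linarith

/-- For every query, the probabilities of a revealing response add up to an exponentially small
fraction of the number of secrets. -/
theorem sum_revealProb_le {H A : ℕ} {r : Finset (Fin p) → List (Fin A) → Fin A → ℝ}
    (hr : ∀ u l a, r u l a ∈ Set.Icc (0 : ℝ) 1)
    (hsmall : ∀ u l a, ¬ aliveStep u l a → (∀ v ∈ (Conf.ofList p (l ++ [a])).visited,
      p ≤ 4 * (v ∆ u).card) → r u l a ≤ (25 / 32) ^ p) (q : (treeSpace A H).State × Fin A) :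
    ∑ u ∈ secrets p, revealProb (treeModel H (aliveStep u) (r u) (hr u)).kernel
        (treeNext (runningStep p)) q ≤
      ENNReal.ofReal (p * (337 / 192) ^ p + (secrets p).card * (25 / 32) ^ p) := by
  classical
  obtain ⟨_ | l, a⟩ := q
  · refine le_trans (le_of_eq (Finset.sum_eq_zero fun u _ => ?_)) bot_le
    refine le_antisymm (((treeModel H (aliveStep u) (r u) (hr u)).revealProb_le_rew
      (treeNext (runningStep p)) (none, a) rfl).trans_eq ?_) bot_le
    exact ENNReal.ofReal_zero
  · refine (Finset.sum_le_sum fun u _ => revealProb_le (hr := hr u) (hsmall u) l a).trans ?_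
    rw [Finset.sum_add_distrib, ENNReal.ofReal_add (by positivity) (by positivity)]
    refine add_le_add ?_ (le_of_eq ?_)
    · rw [Finset.sum_comm]
      calc _ ≤ ∑ v ∈ (Conf.ofList p (l.1 ++ [a])).visited.toFinset,
            ENNReal.ofReal ((337 / 192) ^ p) := by
            refine Finset.sum_le_sum fun v _ => ?_
            refine le_trans (Finset.sum_le_sum_of_subset (Finset.subset_univ _)) ?_
            rw [← Finset.sum_filter, Finset.sum_const, nsmul_eq_mul, mul_one,
              ← ENNReal.ofReal_natCast]
            exact ENNReal.ofReal_le_ofReal (card_close_le v)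
        _ ≤ ENNReal.ofReal (p * (337 / 192) ^ p) := by
            rw [Finset.sum_const, nsmul_eq_mul, ENNReal.ofReal_mul (Nat.cast_nonneg p),
              ENNReal.ofReal_natCast]
            gcongr
            exact (List.toFinset_card_le _).trans (Conf.length_visited_le _)
    · rw [Finset.sum_const, nsmul_eq_mul, ENNReal.ofReal_mul (Nat.cast_nonneg _),
        ENNReal.ofReal_natCast]

end Counting

/-! ### The lower bound -/

section Final

variable {H A p : ℕ}

/-- The lower bound for the hard family, with a number `n` of rounds to be chosen. -/
theorem le_queryComplexity_of_hardFamily {F : Type → Type} (𝓜 : Set (FMDP H A F)) {δ : ℝ}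
    (hδ : δ ≤ 1 / 100) (φ : F (treeSpace A H).State) (hp : 0 < p) (hH : p * (p + 1) ≤ H)
    {r : Finset (Fin p) → List (Fin A) → Fin A → ℝ}
    (hr : ∀ u l a, r u l a ∈ Set.Icc (0 : ℝ) 1)
    (hsmall : ∀ u l a, ¬ aliveStep u l a → (∀ v ∈ (Conf.ofList p (l ++ [a])).visited,
      p ≤ 4 * (v ∆ u).card) → r u l a ≤ (25 / 32) ^ p)
    {v : Finset (Fin p) → List (Fin A) → ℝ} (hv : ∀ u, v u [] = seqValue u ([] : List (Fin A)))
    (hsol : ∀ u : Finset (Fin p), p ≤ 4 * u.card → IsTreeSolution H (aliveStep u) (r u) (v u))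
    (hmem : ∀ u : Finset (Fin p), p ≤ 4 * u.card →
      (⟨(treeModel H (aliveStep u) (r u) (hr u)).toMDP, φ⟩ : FMDP H A F) ∈ 𝓜)
    (x : ℝ) (hx : 1 ≤ x) (hpx : 528 * (p : ℝ) ^ 3 * (8 / 9) ^ p * x < 2) :
    ENNReal.ofReal x ≤ queryComplexity 𝓜 δ := by
  have hp1 : (1 : ℝ) ≤ p := by exact_mod_cast hp
  have hT : 0 < p * (p + 1) := by positivity
  set T := p * (p + 1) with hTdef
  have hTr : (T : ℝ) = p * (p + 1) := by rw [hTdef]; push_cast; ring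
  have hT2 : (T : ℝ) ≤ 2 * p ^ 2 := by rw [hTr]; nlinarith
  have hT1 : (2 : ℝ) ≤ T := by rw [hTr]; nlinarith
  set n := ⌈8 * (T * x)⌉₊ with hn
  have hn1 : 8 * (T * x) ≤ (n : ℝ) := Nat.le_ceil _
  have hn2 : (n : ℝ) < 8 * (T * x) + 1 := Nat.ceil_lt_add_one (by positivity)
  have hTx : (T : ℝ) ≤ T * x := le_mul_of_one_le_right (by positivity) hx
  have hn0 : n ≠ 0 := by
    rintro h
    rw [h] at hn1
    push_cast at hn1
    linarith
  refine le_queryComplexity 𝓜 δ hδ φ (secrets p)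
    (fun u => treeModel H (aliveStep u) (r u) (hr u))
    (fun u hu => hmem u (Finset.mem_filter.1 hu).2) (some ⟨[], hT.trans_le hH⟩) rfl
    (fun u hu => ?_) (treeNext (runningStep p)) T (fun _ => rfl)
    (fun s a hs => treeNext_runningStep hH s a hs) hT hH _ (sum_revealProb_le hr hsmall) n hn0 _
    ?_ ?_
  · rw [(hsol u (Finset.mem_filter.1 hu).2).vStar_eq]
    change _ ≤ ENNReal.ofReal (v u [])
    rw [hv, seqValue_nil]
    refine le_trans (le_of_eq ?_) (ENNReal.ofReal_le_ofReal (half_le_decay _))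
    rw [ENNReal.ofReal_div_of_pos (by norm_num)]
    simp
  · have h := ENNReal.ofReal_le_ofReal hn1
    rw [ENNReal.ofReal_mul (by norm_num), ENNReal.ofReal_mul (by positivity),
      ENNReal.ofReal_natCast, ENNReal.ofReal_natCast] at h
    simpa using h
  · set w : ℝ := ((secrets p).card : ℝ) with hw
    have hwE : ((secrets p).card : ℝ≥0∞) / 4 = ENNReal.ofReal (w / 4) := by
      rw [ENNReal.ofReal_div_of_pos (by norm_num), hw, ENNReal.ofReal_natCast]
      simp
    rw [hwE, ← ENNReal.ofReal_natCast, ← ENNReal.ofReal_mul (Nat.cast_nonneg _)]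
    set y : ℝ := (8 / 9) ^ p with hy
    have hy0 : 0 < y := by positivity
    have hp3 : (1 : ℝ) ≤ p ^ 3 := one_le_pow₀ hp1
    have hy1 : y ≤ 1 / 4 := by
      have h1 : y * 1 ≤ y * ((p : ℝ) ^ 3 * x) :=
        mul_le_mul_of_nonneg_left (one_le_mul_of_one_le_of_one_le hp3 hx) hy0.le
      linarith [h1, hpx]
    have h2p : (0 : ℝ) < 2 ^ p := by positivity
    have h337 : (337 / 192 : ℝ) ^ p ≤ 2 ^ p * y := by
      rw [hy, ← mul_pow]
      exact pow_le_pow_left₀ (by norm_num) (by norm_num) p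
    have hwy : (2 : ℝ) ^ p ≤ 2 * w := by
      have h := le_card_secrets p
      nlinarith
    have hw0 : 0 < w := by linarith
    have h25 : (25 / 32 : ℝ) ^ p ≤ y := pow_le_pow_left₀ (by norm_num) (by norm_num) p
    have hb : p * (337 / 192 : ℝ) ^ p + w * (25 / 32) ^ p ≤ 3 * p * y * w := by
      have h1 : p * (337 / 192 : ℝ) ^ p ≤ p * (2 * w * y) :=
        mul_le_mul_of_nonneg_left (h337.trans (mul_le_mul_of_nonneg_right hwy hy0.le))
          (by positivity)
      have h2 : w * (25 / 32 : ℝ) ^ p ≤ w * (p * y) :=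
        mul_le_mul_of_nonneg_left (h25.trans (le_mul_of_one_le_left hy0.le hp1)) hw0.le
      linarith
    have hnT : ((n + T : ℕ) : ℝ) ≤ 11 * (2 * p ^ 2) * x := by
      push_cast
      have h1 : (T : ℝ) * x ≤ 2 * p ^ 2 * x := mul_le_mul_of_nonneg_right hT2 (by linarith)
      linarith
    refine (ENNReal.ofReal_lt_ofReal_iff (by positivity)).2 ?_
    calc ((n + T : ℕ) : ℝ) * (p * (337 / 192 : ℝ) ^ p + w * (25 / 32) ^ p)
        ≤ (11 * (2 * p ^ 2) * x) * (3 * p * y * w) :=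
          mul_le_mul hnT hb (by positivity) (by positivity)
      _ = (528 * p ^ 3 * y * x) * (w / 8) := by ring
      _ < 2 * (w / 8) := mul_lt_mul_of_pos_right hpx (by positivity)
      _ = w / 4 := by ring

variable {d : ℕ}

theorem factor_ofList_mem (l : List (Fin A)) :
    (Conf.ofList p l).factor ∈ Set.Icc (0 : ℝ) 1 :=
  ⟨(Conf.factor_mem l).1, Conf.factor_le_one l⟩

/-- State features of the hard family. -/
def stateFeature (e : TensorIndex p ↪ Fin d) : FeatV d (treeSpace A H).State := fun s =>
  s.elim 0 fun l => confFeature e (Conf.ofList p l.1)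

/-- State-action features of the hard family. -/
def actionFeature (e : TensorIndex p ↪ Fin d) : FeatQ d A (treeSpace A H).State := fun s a =>
  s.elim 0 fun l => confFeature e (Conf.ofList p (l.1 ++ [a]))

theorem norm_stateFeature_le (e : TensorIndex p ↪ Fin d) (s : (treeSpace A H).State) :
    ‖stateFeature e s‖ ≤ 1 := by
  cases s with
  | none => simp [stateFeature]
  | some l => exact norm_confFeature_le e (factor_ofList_mem l.1)

theorem norm_actionFeature_le (e : TensorIndex p ↪ Fin d) (s : (treeSpace A H).State)
    (a : Fin A) : ‖actionFeature e s a‖ ≤ 1 := by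
  cases s with
  | none => simp [actionFeature]
  | some l => exact norm_confFeature_le e (factor_ofList_mem (l.1 ++ [a]))

theorem le_queryComplexity_classes {δ B : ℝ} (hδ : δ ≤ 1 / 100) (hB : 315 ≤ B) (hp : 0 < p)
    (hA : p ≤ A) (hH : p * (p + 1) ≤ H) (hd : (p + 1) ^ 4 ≤ d)
    (x : ℝ) (hx : 1 ≤ x) (hpx : 528 * (p : ℝ) ^ 3 * (8 / 9) ^ p * x < 2) :
    ENNReal.ofReal x ≤ queryComplexity (classV B d H A ∩ classPdet H A (FeatV d)) δ ∧
    ENNReal.ofReal x ≤ queryComplexity (classQ B d H A ∩ classPdet H A (FeatQ d A)) δ ∧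
    ENNReal.ofReal x ≤
      queryComplexity (classReach B d H A ∩ classPdet H A (FeatVQ d A)) δ := by
  obtain ⟨e⟩ := nonempty_tensorIndex_embedding hd
  have hH0 : 0 < H := (by positivity : 0 < p * (p + 1)).trans_le hH
  have hθ : ∀ u, ‖secretVec e u‖ ≤ B := fun u => (norm_secretVec_le e u).trans (by linarith)
  have hq : ∀ u : Finset (Fin p), p ≤ 4 * u.card → ∀ (s : (treeSpace A H).State) a,
      ((treeModel H (aliveStep u) (actionPayoff u) (actionPayoff_mem u)).toMDP.qStar s a).toReal =
        inner ℝ (actionFeature e s a) (secretVec e u) := by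
    rintro u hu (_ | l) a
    · rw [(isTreeSolution_actionPayoff hp hA hH hu).qStar_none hH0]
      exact (inner_zero_left _).symm
    · rw [(isTreeSolution_actionPayoff hp hA hH hu).qStar_some,
        ENNReal.toReal_ofReal (actionPayoff_mem u l.1 a).1]
      exact (inner_confFeature e _ u).symm
  refine ⟨?_, ?_, ?_⟩
  · refine le_queryComplexity_of_hardFamily (F := FeatV d)
      (classV B d H A ∩ classPdet H A (FeatV d)) hδ (stateFeature e) hp hH
      (r := fun u => statePayoff u) (fun u => statePayoff_mem u)
      (fun u l a => statePayoff_small l a) (v := fun u => seqValue u) (fun _ => rfl)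
      (fun u hu => isTreeSolution_statePayoff hp hA hH hu) (fun u hu => ⟨⟨?_, ?_⟩, ?_⟩) x hx hpx
    · exact norm_stateFeature_le e
    · refine ⟨secretVec e u, hθ u, fun s => ?_⟩
      refine (congrArg ENNReal.toReal
        ((isTreeSolution_statePayoff hp hA hH hu).vStar_eq s)).trans ?_
      rcases s with _ | l
      · exact (inner_zero_left _).symm
      · refine (ENNReal.toReal_ofReal (seqValue_mem u l.1).1).trans ?_
        exact (inner_confFeature e _ u).symm
    · exact DetModel.detTransitions _
  · refine le_queryComplexity_of_hardFamily (F := FeatQ d A)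
      (classQ B d H A ∩ classPdet H A (FeatQ d A)) hδ (actionFeature e) hp hH
      (r := fun u => actionPayoff u) (fun u => actionPayoff_mem u)
      (fun u l a => actionPayoff_small l a) (v := fun u => maxValue u)
      (fun u => if_pos (alive_nil hp u))
      (fun u hu => isTreeSolution_actionPayoff hp hA hH hu) (fun u hu => ⟨⟨?_, ?_⟩, ?_⟩) x hx hpx
    · exact norm_actionFeature_le e
    · exact ⟨secretVec e u, hθ u, hq u hu⟩
    · exact DetModel.detTransitions _
  · refine le_queryComplexity_of_hardFamily (F := FeatVQ d A)
      (classReach B d H A ∩ classPdet H A (FeatVQ d A)) hδ (stateFeature e, actionFeature e) hp hH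
      (r := fun u => actionPayoff u) (fun u => actionPayoff_mem u)
      (fun u l a => actionPayoff_small l a) (v := fun u => maxValue u)
      (fun u => if_pos (alive_nil hp u))
      (fun u hu => isTreeSolution_actionPayoff hp hA hH hu)
      (fun u hu => ⟨⟨?_, ?_, ?_⟩, ?_⟩) x hx hpx
    · exact norm_stateFeature_le e
    · exact norm_actionFeature_le e
    · refine ⟨secretVec e u, hθ u, fun s hs => ⟨?_, hq u hu s⟩⟩
      refine (congrArg ENNReal.toReal
        ((isTreeSolution_actionPayoff hp hA hH hu).vStar_eq s)).trans ?_
      rcases alive_of_reachable hp hs with rfl | ⟨l, rfl, hl⟩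
      · exact (inner_zero_left _).symm
      · change (ENNReal.ofReal (maxValue u l.1)).toReal = _
        rw [maxValue, if_pos hl, ENNReal.toReal_ofReal (seqValue_mem u l.1).1]
        exact (inner_confFeature e _ u).symm
    · exact DetModel.detTransitions _

/-- Exponential growth beats the polynomial losses. -/
theorem exists_forall_pow_lt : ∃ N : ℕ, ∀ p : ℕ, N ≤ p → ∀ m : ℝ, m < p + 2 →
    528 * (p : ℝ) ^ 3 * (8 / 9) ^ p * 2 ^ (1 / 16 * m) < 2 := by
  have h := tendsto_pow_const_mul_const_pow_of_abs_lt_one 3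
    (r := (17 / 18 : ℝ)) (by rw [abs_of_pos] <;> norm_num)
  obtain ⟨N, hN⟩ := Filter.eventually_atTop.1
    (h.eventually (gt_mem_nhds (by norm_num : (0 : ℝ) < 1 / 528)))
  refine ⟨N, fun p hp m hm => ?_⟩
  have h1 := hN p hp
  have h2 : (2 : ℝ) ^ (1 / 16 * m) ≤ 2 * (17 / 16) ^ p := by
    calc (2 : ℝ) ^ (1 / 16 * m) ≤ 2 ^ (1 / 16 * (p : ℝ) + 1) :=
          Real.rpow_le_rpow_of_exponent_le (by norm_num) (by linarith)
      _ = 2 * (2 ^ (1 / 16 : ℝ)) ^ p := by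
          rw [Real.rpow_add (by norm_num), Real.rpow_one, Real.rpow_mul (by norm_num),
            Real.rpow_natCast, mul_comm]
      _ ≤ 2 * (17 / 16) ^ p := by
          gcongr
          rw [one_div, Real.rpow_inv_le_iff_of_pos (by norm_num) (by norm_num) (by norm_num)]
          norm_num
  have h3 : (8 / 9 : ℝ) ^ p * (17 / 16) ^ p = (17 / 18) ^ p := by
    rw [← mul_pow]; norm_num
  calc 528 * (p : ℝ) ^ 3 * (8 / 9) ^ p * (2 : ℝ) ^ (1 / 16 * m)
      ≤ 528 * (p : ℝ) ^ 3 * (8 / 9) ^ p * (2 * (17 / 16) ^ p) := by gcongr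
    _ = 1056 * ((p : ℝ) ^ 3 * (17 / 18) ^ p) := by rw [← h3]; ring
    _ < 2 := by linarith

end Final

end OnlinePlanning

end

theorem theorem1 :
    ∃ c : ℝ, 0 < c ∧ ∃ d₀ H₀ : ℕ, ∀ (δ B : ℝ) (d H A : ℕ),
      0 < δ → δ ≤ 1 / 100 → 315 ≤ B → d₀ ≤ d → H₀ ≤ H →
      min ((d : ℝ) ^ (1 / 4 : ℝ)) ((H : ℝ) ^ (1 / 2 : ℝ)) ≤ (A : ℝ) →
      ENNReal.ofReal ((2 : ℝ) ^ (c * min ((d : ℝ) ^ (1 / 4 : ℝ)) ((H : ℝ) ^ (1 / 2 : ℝ)))) ≤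
          OnlinePlanning.queryComplexity
            (OnlinePlanning.classV B d H A ∩
              OnlinePlanning.classPdet H A (OnlinePlanning.FeatV d)) δ ∧
      ENNReal.ofReal ((2 : ℝ) ^ (c * min ((d : ℝ) ^ (1 / 4 : ℝ)) ((H : ℝ) ^ (1 / 2 : ℝ)))) ≤
          OnlinePlanning.queryComplexity
            (OnlinePlanning.classQ B d H A ∩
              OnlinePlanning.classPdet H A (OnlinePlanning.FeatQ d A)) δ ∧
      ENNReal.ofReal ((2 : ℝ) ^ (c * min ((d : ℝ) ^ (1 / 4 : ℝ)) ((H : ℝ) ^ (1 / 2 : ℝ)))) ≤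
          OnlinePlanning.queryComplexity
            (OnlinePlanning.classReach B d H A ∩
              OnlinePlanning.classPdet H A (OnlinePlanning.FeatVQ d A)) δ := by
  obtain ⟨N, hN⟩ := OnlinePlanning.exists_forall_pow_lt
  refine ⟨1 / 16, by norm_num, (N + 2) ^ 4, (N + 2) ^ 2, ?_⟩
  intro δ B d H A _ hδ hB hd hH hA
  set m := min ((d : ℝ) ^ (1 / 4 : ℝ)) ((H : ℝ) ^ (1 / 2 : ℝ)) with hm
  have hroot : ∀ k n : ℕ, k ≠ 0 → (N + 2) ^ k ≤ n → ((N + 2 : ℕ) : ℝ) ≤ (n : ℝ) ^ (k⁻¹ : ℝ) := by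
    intro k n hk hn
    rw [Real.le_rpow_inv_iff_of_pos (Nat.cast_nonneg _) (Nat.cast_nonneg _)
      (by exact_mod_cast Nat.pos_of_ne_zero hk), Real.rpow_natCast]
    exact_mod_cast hn
  have hmN : ((N + 2 : ℕ) : ℝ) ≤ m := by
    refine le_min ?_ ?_
    · have h := hroot 4 d (by norm_num) hd
      norm_num at h ⊢
      exact h
    · have h := hroot 2 H (by norm_num) hH
      norm_num at h ⊢
      exact h
  have hm0 : 0 ≤ m := (Nat.cast_nonneg _).trans hmN
  -- The dimension `p` of the cube is chosen with `p + 1 ≤ m < p + 2`.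
  obtain ⟨p, hp⟩ : ∃ p, ⌊m⌋₊ = p + 1 := by
    refine Nat.exists_eq_add_of_le' ?_
    have := Nat.le_floor hmN
    omega
  have hNp : N + 1 ≤ p := by
    have := Nat.le_floor hmN
    omega
  have hpm : ((p + 1 : ℕ) : ℝ) ≤ m := hp ▸ Nat.floor_le hm0
  have hmp : m < p + 2 := by
    have h := Nat.lt_floor_add_one m
    rw [hp] at h
    push_cast at h
    linarith
  have hpow : ∀ k n : ℕ, k ≠ 0 → m ≤ (n : ℝ) ^ (k⁻¹ : ℝ) → (p + 1) ^ k ≤ n := by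
    intro k n hk hn
    have h := hpm.trans hn
    rw [Real.le_rpow_inv_iff_of_pos (Nat.cast_nonneg _) (Nat.cast_nonneg _)
      (by exact_mod_cast Nat.pos_of_ne_zero hk), Real.rpow_natCast] at h
    exact_mod_cast h
  have hpd : (p + 1) ^ 4 ≤ d := hpow 4 d (by norm_num) (by
    have := min_le_left ((d : ℝ) ^ (1 / 4 : ℝ)) ((H : ℝ) ^ (1 / 2 : ℝ))
    rw [← hm] at this
    norm_num at this ⊢
    exact this)
  have hpH : (p + 1) ^ 2 ≤ H := hpow 2 H (by norm_num) (by
    have := min_le_right ((d : ℝ) ^ (1 / 4 : ℝ)) ((H : ℝ) ^ (1 / 2 : ℝ))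
    rw [← hm] at this
    norm_num at this ⊢
    exact this)
  have hpA : p ≤ A := by
    have h : p + 1 ≤ A := by exact_mod_cast hpm.trans hA
    omega
  exact OnlinePlanning.le_queryComplexity_classes hδ hB (by omega) hpA
    (le_trans (by nlinarith) hpH) hpd _
    (Real.one_le_rpow (by norm_num) (by positivity)) (hN p (by omega) m hmp)
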